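/- Let $\mathfrak n$ be a non-commutative real Lie algebra with a basis $Z_1,\dots,Z_m,Y_1,\dots,Y_d,X_1,\dots,X_d$ (so $n=\dim\mathfrak n=m+2d$) such that the $Z_l$ span the centre of $\mathfrak n$, $[Y_i,Y_j]=[X_i,X_j]=0$, each $[X_i,Y_j]$ is central, and $\lambda\mapsto\det(\lambda[X_i,Y_j])_{i,j}$ is a nonzero polynomial function on $\mathfrak n^*$. Let $N=\exp\mathfrak n$ be the simply connected, connected (step-two) nilpotent Lie group of $\mathfrak n$, with coordinates $(z,y,x)\mapsto \exp(\sum z_lZ_l)\exp(\sum y_iY_i)\exp(\sum x_iX_i)$ and Haar measure $dz\,dy\,dx$. Let $L$ be the left regular representation on $L^2(N)$, and put $\Gamma=\exp(\sum_l\mathbb Z Z_l)\exp(\sum_i\mathbb Z Y_i)\exp(\sum_i\mathbb Z X_i)$. Let $A$ be the automorphism of $N$ given in coordinates by $(z,y,x)\mapsto(2z,2y,x)$, and for $j\in\mathbb Z$ put $(D_{A^j}f)(a)=2^{-j(n-d)/2}f(A^{-j}a)$. For $\lambda\in\mathbb R^m$, regarded as the functional with $\lambda(Z_l)=\lambda_l$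 and $\lambda(Y_i)=\lambda(X_i)=0$, put $B(\lambda)=(\lambda[X_i,Y_j])_{i,j}$, and let $\Sigma=\{\lambda:\det B(\lambda)\ne0\}$, with the Plancherel measure $|\det B(\lambda)|\,d\lambda$. For $\lambda\in\Sigma$ let $\pi_\lambda$ be the irreducible representation on $L^2(\mathbb R^d)$ given by $$(\pi_\lambda(z,y,x)\varphi)(t)=e^{2\pi i\langle\lambda,z\rangle}e^{-2\pi i\langle t,B(\lambda)y\rangle}\varphi(t-x).$$ Let $\mathcal P:L^2(N)\to\int_\Sigma^\oplus L^2(\mathbb R^d)\otimes L^2(\mathbb R^d)\,|\det B(\lambda)|\,d\lambda$ (with values in the Hilbert–Schmidt operators, $\varphi\otimes e$ being the operator $u\mapsto\langle u,e\rangle\varphi$) be the Plancherel transform, that is the continuous extension of $f\mapsto\left(\int_N f(a)\pi_\lambda(a)\,da\right)_\lambda$ from $L^1(N)\cap L^2(N)$. Let $E=\left([-\tfrac12,\tfrac12]^m\setminus[-\tfrac14,\tfrac14]^m\right)\cap\Sigma$. Fix an orthonormal basis $\{e_k:k\in\mathbb I\}$ of $L^2(\mathbb R^d)$ and put $$H_E^{j,k}=\mathcal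 P^{-1}\left(\int_{2^{-j}E}^\oplus\left(L^2(\mathbb R^d)\otimes e_k\right)|\det B(\lambda)|\,d\lambda\right)\qquad(j\in\mathbb Z,\ k\in\mathbb I).$$ A family $(v_i)$ in a closed subspace $K$ of a Hilbert space is called a Parseval frame for $K$ if $\sum_i|\langle g,v_i\rangle|^2=\|g\|^2$ for all $g\in K$. **Theorem.** (1) Let $S\subset\mathbb I$ be finite and, for each $k\in S$, let $f_k\in L^2(N)$ be such that $\{L(\gamma)f_k:\gamma\in\Gamma\}$ is a Parseval frame for $H_E^{0,k}$. Then the spaces $H_E^{j,k}$, $(k,j)\in S\times\mathbb Z$, are pairwise orthogonal, and $\{D_{A^j}L(\gamma)f_k:\gamma\in\Gamma,\ j\in\mathbb Z,\ k\in S\}$ is a Parseval frame for $\bigoplus_{(k,j)\in S\times\mathbb Z}H_E^{j,k}$ (the closed linear span of these spaces in $L^2(N)$). (2) If for every $k\in\mathbb I$ the function $f_k\in L^2(N)$ is such that $\{L(\gamma)f_k:\gamma\in\Gamma\}$ is a Parseval frame for $H_E^{0,k}$, then $\{D_{A^j}L(\gamma)f_k:\gamma\in\Gamma,\ j\in\mathbb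 Z,\ k\in\mathbb I\}$ is a Parseval frame for $L^2(N)$. -/

import Mathlib

open MeasureTheory Filter Topology
open scoped ENNReal Pointwise

noncomputable section

/-- Euclidean space `ℝ^k`. -/
abbrev Euc (k : ℕ) : Type := EuclideanSpace ℝ (Fin k)

/-- The Hilbert space `L²(ℝ^d)`. -/
abbrev L2R (d : ℕ) : Type := Lp ℂ 2 (volume : Measure (Euc d))

instance separableSpace_L2R (d : ℕ) : TopologicalSpace.SeparableSpace (L2R d) := by
  have : Fact ((2 : ℝ≥0∞) ≠ ∞) := ⟨ENNReal.ofNat_ne_top⟩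
  infer_instance

/-! ### Parseval frames -/

/-- A family `v` of vectors of `H` is a Parseval frame for the subspace `K`: its members lie in `K`
and `∑ i, |⟪g, v i⟫|² = ‖g‖²` for all `g ∈ K`. -/
def IsParsevalFrame {H : Type*} [NormedAddCommGroup H] [InnerProductSpace ℂ H] {ι : Type*}
    (v : ι → H) (K : Submodule ℂ H) : Prop :=
  (∀ i, v i ∈ K) ∧ ∀ g ∈ K, HasSum (fun i => ‖inner ℂ (v i) g‖ ^ 2) (‖g‖ ^ 2)

/-! ### Hilbert–Schmidt norm and measurable fields of operators -/

section HilbertSchmidt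

set_option linter.unusedSectionVars false

variable {H : Type*} [NormedAddCommGroup H] [InnerProductSpace ℂ H]

theorem enorm_sq_eq_tsum {ι : Type*} (b : HilbertBasis ι ℂ H) (x : H) :
    ‖x‖ₑ ^ 2 = ∑' i, ‖inner ℂ (b i) x‖ₑ ^ 2 := by
  have h := b.hasSum_inner_mul_inner x x
  have h2 : HasSum (fun i => ‖inner ℂ (b i) x‖ ^ 2) (‖x‖ ^ 2) := by
    rw [← Complex.hasSum_ofReal]
    have e1 : (fun i => inner ℂ x (b i) * inner ℂ (b i) x)
        = fun i => ((‖inner ℂ (b i) x‖ ^ 2 : ℝ) : ℂ) := by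
      funext i
      rw [← inner_conj_symm x (b i), ← Complex.normSq_eq_conj_mul_self, Complex.normSq_eq_norm_sq]
    have e2 : inner ℂ x x = ((‖x‖ ^ 2 : ℝ) : ℂ) := by
      rw [inner_self_eq_norm_sq_to_K]; norm_cast
    rwa [e1, e2] at h
  have h3 : ∀ y : ℝ, 0 ≤ y → ENNReal.ofReal (y ^ 2) = (ENNReal.ofReal y) ^ 2 := fun y hy =>
    ENNReal.ofReal_pow hy 2
  simp only [← ofReal_norm]
  rw [← h3 _ (norm_nonneg _), ← h2.tsum_eq,
    ENNReal.ofReal_tsum_of_nonneg (fun i => by positivity) h2.summable]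
  exact tsum_congr fun i => h3 _ (norm_nonneg _)

variable [CompleteSpace H]

variable (H) in
/-- An orthonormal basis of `H`. -/
def someBasis : HilbertBasis (exists_hilbertBasis ℂ H).choose ℂ H :=
  (exists_hilbertBasis ℂ H).choose_spec.choose

/-- The square `‖T‖²_HS = ∑ i, ‖T b_i‖²` of the Hilbert–Schmidt norm of `T`, for an orthonormal
basis `b` of `H`; by `hsNormSq_eq` it does not depend on the choice of the basis. -/
def hsNormSq (T : H →L[ℂ] H) : ℝ≥0∞ :=
  ∑' i, ‖T (someBasis H i)‖ₑ ^ 2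

theorem hsNormSq_eq {ι : Type*} (b : HilbertBasis ι ℂ H) (T : H →L[ℂ] H) :
    hsNormSq T = ∑' i, ‖T (b i)‖ₑ ^ 2 := by
  have key : ∑' i, ‖T (someBasis H i)‖ₑ ^ 2 = ∑' j, ‖T.adjoint (someBasis H j)‖ₑ ^ 2 := by
    simp_rw [enorm_sq_eq_tsum (someBasis H) (T _), enorm_sq_eq_tsum (someBasis H) (T.adjoint _)]
    rw [ENNReal.tsum_comm]
    refine tsum_congr fun j => tsum_congr fun i => ?_
    rw [ContinuousLinearMap.adjoint_inner_right, ← inner_conj_symm]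
    simp only [← ofReal_norm, RCLike.norm_conj]
  have key' : ∑' i, ‖T (b i)‖ₑ ^ 2 = ∑' j, ‖T.adjoint (someBasis H j)‖ₑ ^ 2 := by
    simp_rw [enorm_sq_eq_tsum (someBasis H) (T _), enorm_sq_eq_tsum b (T.adjoint _)]
    rw [ENNReal.tsum_comm]
    refine tsum_congr fun j => tsum_congr fun i => ?_
    rw [ContinuousLinearMap.adjoint_inner_right, ← inner_conj_symm]
    simp only [← ofReal_norm, RCLike.norm_conj]
  rw [key', ← key]
  rfl

theorem hsNormSq_add_le (S T : H →L[ℂ] H) :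
    hsNormSq (S + T) ≤ 2 * hsNormSq S + 2 * hsNormSq T := by
  unfold hsNormSq
  rw [← ENNReal.tsum_mul_left, ← ENNReal.tsum_mul_left, ← ENNReal.tsum_add]
  refine ENNReal.tsum_le_tsum fun i => ?_
  have h1 : ‖(S + T) (someBasis H i)‖ₑ ^ 2
      ≤ (‖S (someBasis H i)‖ₑ + ‖T (someBasis H i)‖ₑ) ^ 2 :=
    pow_le_pow_left' (enorm_add_le _ _) 2
  refine h1.trans ?_
  have h2 := ENNReal.rpow_add_le_mul_rpow_add_rpow (‖S (someBasis H i)‖ₑ)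
    (‖T (someBasis H i)‖ₑ) (p := 2) (by norm_num)
  rw [← mul_add]
  have e : (2 : ℝ≥0∞) ^ ((2 : ℝ) - 1) = 2 := by norm_num
  rw [e] at h2
  simpa using h2

theorem hsNormSq_smul (c : ℂ) (T : H →L[ℂ] H) :
    hsNormSq (c • T) = ‖c‖ₑ ^ 2 * hsNormSq T := by
  unfold hsNormSq
  rw [← ENNReal.tsum_mul_left]
  refine tsum_congr fun i => ?_
  simp [enorm_smul, mul_pow]

/-- A (weakly) measurable field of bounded operators on `H`, with respect to the measure `μ`. -/
def IsMeasurableField {Ω : Type*} [MeasurableSpace Ω] (μ : Measure Ω) (T : Ω → H →L[ℂ] H) : Prop :=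
  ∀ u v : H, AEMeasurable (fun ω => inner ℂ v (T ω u)) μ

section

variable {Ω : Type*} [MeasurableSpace Ω] {μ : Measure Ω} {S T : Ω → H →L[ℂ] H}

theorem IsMeasurableField.add (hS : IsMeasurableField μ S) (hT : IsMeasurableField μ T) :
    IsMeasurableField μ (S + T) := by
  intro u v
  simp only [Pi.add_apply, add_apply, inner_add_right]
  exact (hS u v).add (hT u v)

theorem IsMeasurableField.sub (hS : IsMeasurableField μ S) (hT : IsMeasurableField μ T) :
    IsMeasurableField μ (S - T) := by
  intro u v
  simp only [Pi.sub_apply, sub_apply, inner_sub_right]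
  exact (hS u v).sub (hT u v)

theorem IsMeasurableField.smul (hS : IsMeasurableField μ S) (c : ℂ) :
    IsMeasurableField μ (c • S) := by
  intro u v
  simpa [inner_smul_right] using (hS u v).const_mul c

end

theorem countable_of_hilbertBasis [TopologicalSpace.SeparableSpace H] {ι : Type*}
    (b : HilbertBasis ι ℂ H) : Countable ι := by
  have hd : (Set.univ : Set ι).PairwiseDisjoint fun i => Metric.ball (b i) (1 / 2) := by
    intro i _ j _ hij
    apply Metric.ball_disjoint_ball
    have h0 : inner ℂ (b i) (b j) = 0 := b.orthonormal.2 hij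
    have h1 : ‖b i - b j‖ ^ 2 = 2 := by
      rw [@norm_sub_sq ℂ, h0, b.orthonormal.1 i, b.orthonormal.1 j]; norm_num
    rw [dist_eq_norm]
    nlinarith [norm_nonneg (b i - b j)]
  have := hd.countable_of_isOpen (fun i _ => Metric.isOpen_ball)
    (fun i _ => Metric.nonempty_ball.2 (by norm_num))
  exact Set.countable_univ_iff.1 this

theorem IsMeasurableField.aemeasurable_hsNormSq [TopologicalSpace.SeparableSpace H] {Ω : Type*}
    [MeasurableSpace Ω] {μ : Measure Ω} {T : Ω → H →L[ℂ] H} (hT : IsMeasurableField μ T) :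
    AEMeasurable (fun ω => hsNormSq (T ω)) μ := by
  have := countable_of_hilbertBasis (someBasis H)
  unfold hsNormSq
  simp_rw [enorm_sq_eq_tsum (someBasis H) (T _ _)]
  refine AEMeasurable.tsum fun i => AEMeasurable.tsum fun j => ?_
  exact (hT _ _).enorm.pow_const 2

end HilbertSchmidt

/-! ### The class of groups -/

/-- A basis `Z_1, …, Z_m, Y_1, …, Y_d, X_1, …, X_d` (so that `dim 𝔫 = n = m + 2d`) of a non
commutative real Lie algebra `𝔫` such that the `Z_l` span the centre, the `Y_i` commute, the `X_i`
commute, every `[X_i, Y_j]` is central, and `λ ↦ det (λ [X_i, Y_j])` is a nonzero polynomial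
function. -/
structure AdaptedBasis (𝔫 : Type*) [LieRing 𝔫] [LieAlgebra ℝ 𝔫] (m d : ℕ) where
  basis : Module.Basis (Fin m ⊕ Fin d ⊕ Fin d) ℝ 𝔫
  not_abelian : ¬ IsLieAbelian 𝔫
  span_center : Submodule.span ℝ (Set.range fun l => basis (Sum.inl l))
    = (LieAlgebra.center ℝ 𝔫).toSubmodule
  lie_Y_Y : ∀ i j, ⁅basis (Sum.inr (Sum.inl i)), basis (Sum.inr (Sum.inl j))⁆ = 0
  lie_X_X : ∀ i j, ⁅basis (Sum.inr (Sum.inr i)), basis (Sum.inr (Sum.inr j))⁆ = 0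
  lie_X_Y : ∀ i j, ⁅basis (Sum.inr (Sum.inr i)), basis (Sum.inr (Sum.inl j))⁆
    ∈ LieAlgebra.center ℝ 𝔫
  det_ne_zero : ∃ lam : Module.Dual ℝ 𝔫, (Matrix.of fun i j : Fin d =>
    lam ⁅basis (Sum.inr (Sum.inr i)), basis (Sum.inr (Sum.inl j))⁆).det ≠ 0

namespace AdaptedBasis

variable {𝔫 : Type*} [LieRing 𝔫] [LieAlgebra ℝ 𝔫] {m d : ℕ} (J : AdaptedBasis 𝔫 m d)

/-- The basis vectors of the centre. -/
def Z (l : Fin m) : 𝔫 := J.basis (Sum.inl l)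

/-- The basis vectors `Y_i`. -/
def Y (i : Fin d) : 𝔫 := J.basis (Sum.inr (Sum.inl i))

/-- The basis vectors `X_i`. -/
def X (i : Fin d) : 𝔫 := J.basis (Sum.inr (Sum.inr i))

/-- `∑ z_l Z_l`. -/
def zvec (z : Euc m) : 𝔫 := ∑ l, z l • J.Z l

/-- `∑ y_i Y_i`. -/
def yvec (y : Euc d) : 𝔫 := ∑ i, y i • J.Y i

/-- `∑ x_i X_i`. -/
def xvec (x : Euc d) : 𝔫 := ∑ i, x i • J.X i

theorem zvec_mem (z : Euc m) : J.zvec z ∈ LieAlgebra.center ℝ 𝔫 := by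
  change _ ∈ (LieAlgebra.center ℝ 𝔫).toSubmodule
  rw [← J.span_center]
  exact Submodule.sum_mem _ fun l _ => Submodule.smul_mem _ _ (Submodule.subset_span ⟨l, rfl⟩)

theorem lie_of_mem {V W : 𝔫} (h : W ∈ LieAlgebra.center ℝ 𝔫) : ⁅V, W⁆ = 0 :=
  (LieModule.mem_maxTrivSubmodule ℝ 𝔫 𝔫 W).1 h V

theorem lie_of_mem' {V W : 𝔫} (h : V ∈ LieAlgebra.center ℝ 𝔫) : ⁅V, W⁆ = 0 := by
  rw [← lie_skew, lie_of_mem h, neg_zero]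

theorem repr_inr_of_mem {V : 𝔫} (h : V ∈ LieAlgebra.center ℝ 𝔫) (i : Fin d ⊕ Fin d) :
    J.basis.repr V (Sum.inr i) = 0 := by
  have h' : V ∈ Submodule.span ℝ (Set.range fun l => J.basis (Sum.inl l)) := by
    rw [J.span_center]; exact h
  have h2 : Submodule.span ℝ (Set.range fun l => J.basis (Sum.inl l))
      ≤ LinearMap.ker (J.basis.coord (Sum.inr i)) := by
    rw [Submodule.span_le]
    rintro _ ⟨l, rfl⟩
    simp
  exact h2 h'

theorem zvec_repr_of_mem {V : 𝔫} (h : V ∈ LieAlgebra.center ℝ 𝔫) :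
    J.zvec (WithLp.toLp 2 fun l => J.basis.repr V (Sum.inl l)) = V := by
  have h1 := J.basis.sum_repr V
  rw [Fintype.sum_sum_type] at h1
  simpa [zvec, Z, J.repr_inr_of_mem h] using h1

theorem decomp (V : 𝔫) : V = J.zvec (WithLp.toLp 2 fun l => J.basis.repr V (Sum.inl l))
    + J.yvec (WithLp.toLp 2 fun l => J.basis.repr V (Sum.inr (Sum.inl l)))
    + J.xvec (WithLp.toLp 2 fun l => J.basis.repr V (Sum.inr (Sum.inr l))) := by
  have h1 := J.basis.sum_repr V
  rw [Fintype.sum_sum_type, Fintype.sum_sum_type, ← add_assoc] at h1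
  exact h1.symm

theorem lie_yvec (y y' : Euc d) : ⁅J.yvec y, J.yvec y'⁆ = 0 := by
  simp [yvec, Y, sum_lie, lie_sum, J.lie_Y_Y]

theorem lie_xvec (x x' : Euc d) : ⁅J.xvec x, J.xvec x'⁆ = 0 := by
  simp [xvec, X, sum_lie, lie_sum, J.lie_X_X]

theorem lie_xvec_yvec_mem (x y : Euc d) : ⁅J.xvec x, J.yvec y⁆ ∈ LieAlgebra.center ℝ 𝔫 := by
  simp only [xvec, yvec, sum_lie, lie_sum, smul_lie, lie_smul]
  exact sum_mem fun i _ => (LieAlgebra.center ℝ 𝔫).smul_mem _ (sum_mem fun j _ =>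
    (LieAlgebra.center ℝ 𝔫).smul_mem _ (J.lie_X_Y _ _))

theorem lie_yvec_xvec_mem (y x : Euc d) : ⁅J.yvec y, J.xvec x⁆ ∈ LieAlgebra.center ℝ 𝔫 := by
  rw [← lie_skew]; exact neg_mem (J.lie_xvec_yvec_mem _ _)

theorem lie_mem_center {m d : ℕ} (J : AdaptedBasis 𝔫 m d) (V W : 𝔫) : ⁅V, W⁆ ∈ LieAlgebra.center ℝ 𝔫 := by
  rw [J.decomp V, J.decomp W]
  simp only [add_lie, lie_add, lie_of_mem (J.zvec_mem _), lie_of_mem' (J.zvec_mem _), J.lie_yvec,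
    J.lie_xvec, zero_add, add_zero]
  exact add_mem (J.lie_xvec_yvec_mem _ _) (J.lie_yvec_xvec_mem _ _)

/-- The simply connected, connected nilpotent Lie group `N = exp 𝔫` of the step-two Lie algebra
`𝔫`: its elements are the `exp V`, `V ∈ 𝔫`, and its product is given by the
Baker–Campbell–Hausdorff formula `exp V exp W = exp (V + W + [V, W] / 2)`. -/
@[ext] structure N (J : AdaptedBasis 𝔫 m d) where
  exp ::
  log : 𝔫

namespace N

variable {J}

instance : Mul J.N := ⟨fun a b => exp (a.log + b.log + (1 / 2 : ℝ) • ⁅a.log, b.log⁆)⟩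
instance : One J.N := ⟨exp 0⟩
instance : Inv J.N := ⟨fun a => exp (-a.log)⟩

@[simp] theorem log_mul (a b : J.N) :
    (a * b).log = a.log + b.log + (1 / 2 : ℝ) • ⁅a.log, b.log⁆ := rfl
@[simp] theorem log_one : (1 : J.N).log = 0 := rfl
@[simp] theorem log_inv (a : J.N) : (a⁻¹).log = -a.log := rfl

instance : Group J.N := Group.ofLeftAxioms
  (by
    intro a b c
    ext
    have h1 := lie_of_mem' (W := c.log) (J.lie_mem_center a.log b.log)
    have h2 := lie_of_mem (V := a.log) (J.lie_mem_center b.log c.log)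
    simp only [log_mul, add_lie, lie_add, smul_lie, lie_smul, h1, h2, smul_add, smul_zero,
      add_zero]
    abel)
  (by intro a; ext; simp)
  (by intro a; ext; simp)

end N

/-! #### The coordinates `(z, y, x) ↦ exp (∑ z_l Z_l) exp (∑ y_i Y_i) exp (∑ x_i X_i)` -/

/-- The group element with coordinates `(z, y, x)`. -/
def point (p : Euc m × Euc d × Euc d) : J.N :=
  N.exp (J.zvec p.1) * N.exp (J.yvec p.2.1) * N.exp (J.xvec p.2.2)

theorem log_point (p : Euc m × Euc d × Euc d) : (J.point p).log =
    J.zvec p.1 + J.yvec p.2.1 + J.xvec p.2.2 + (1 / 2 : ℝ) • ⁅J.yvec p.2.1, J.xvec p.2.2⁆ := by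
  simp [point, lie_of_mem' (J.zvec_mem _)]

theorem repr_zvec_inl (z : Euc m) (l : Fin m) : J.basis.repr (J.zvec z) (Sum.inl l) = z l := by
  simp [zvec, Z, Finsupp.single_apply]

theorem repr_yvec_inl (y : Euc d) (l : Fin m) : J.basis.repr (J.yvec y) (Sum.inl l) = 0 := by
  simp [yvec, Y]

theorem repr_xvec_inl (x : Euc d) (l : Fin m) : J.basis.repr (J.xvec x) (Sum.inl l) = 0 := by
  simp [xvec, X, Finsupp.single_apply]

theorem repr_yvec_y (y : Euc d) (i : Fin d) :
    J.basis.repr (J.yvec y) (Sum.inr (Sum.inl i)) = y i := by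
  simp [yvec, Y, Finsupp.single_apply]

theorem repr_xvec_y (x : Euc d) (i : Fin d) :
    J.basis.repr (J.xvec x) (Sum.inr (Sum.inl i)) = 0 := by
  simp [xvec, X, Finsupp.single_apply]

theorem repr_yvec_x (y : Euc d) (i : Fin d) :
    J.basis.repr (J.yvec y) (Sum.inr (Sum.inr i)) = 0 := by
  simp [yvec, Y, Finsupp.single_apply]

theorem repr_xvec_x (x : Euc d) (i : Fin d) :
    J.basis.repr (J.xvec x) (Sum.inr (Sum.inr i)) = x i := by
  simp [xvec, X, Finsupp.single_apply]

/-- The `y`-coordinates of a group element. -/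
def yCoord (a : J.N) : Euc d := WithLp.toLp 2 fun i => J.basis.repr a.log (Sum.inr (Sum.inl i))

/-- The `x`-coordinates of a group element. -/
def xCoord (a : J.N) : Euc d := WithLp.toLp 2 fun i => J.basis.repr a.log (Sum.inr (Sum.inr i))

/-- The `z`-coordinates of a group element. -/
def zCoord (a : J.N) : Euc m := WithLp.toLp 2 fun l => J.basis.repr
  (a.log - (1 / 2 : ℝ) • ⁅J.yvec (J.yCoord a), J.xvec (J.xCoord a)⁆) (Sum.inl l)

theorem yCoord_point (p : Euc m × Euc d × Euc d) : J.yCoord (J.point p) = p.2.1 := by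
  ext i
  simp [yCoord, log_point, J.repr_inr_of_mem (J.zvec_mem _), repr_yvec_y, repr_xvec_y,
    J.repr_inr_of_mem (J.lie_yvec_xvec_mem _ _)]

theorem xCoord_point (p : Euc m × Euc d × Euc d) : J.xCoord (J.point p) = p.2.2 := by
  ext i
  simp [xCoord, log_point, J.repr_inr_of_mem (J.zvec_mem _), repr_yvec_x, repr_xvec_x,
    J.repr_inr_of_mem (J.lie_yvec_xvec_mem _ _)]

theorem zCoord_point (p : Euc m × Euc d × Euc d) : J.zCoord (J.point p) = p.1 := by
  ext l
  simp only [zCoord, yCoord_point, xCoord_point, log_point, add_sub_cancel_right]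
  simp [repr_zvec_inl, repr_yvec_inl, repr_xvec_inl]

/-- The coordinates `(z, y, x)` on `N`. -/
def coords : J.N ≃ Euc m × Euc d × Euc d where
  toFun a := (J.zCoord a, J.yCoord a, J.xCoord a)
  invFun := J.point
  left_inv a := by
    ext1
    rw [log_point]
    set y := J.yCoord a with hy
    set x := J.xCoord a with hx
    have h := J.decomp (a.log - (1 / 2 : ℝ) • ⁅J.yvec y, J.xvec x⁆)
    have e1 : (WithLp.toLp 2 fun l => J.basis.repr
        (a.log - (1 / 2 : ℝ) • ⁅J.yvec y, J.xvec x⁆) (Sum.inr (Sum.inl l)) : Euc d) = y := by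
      ext i
      simp [hy, yCoord, J.repr_inr_of_mem (J.lie_yvec_xvec_mem _ _)]
    have e2 : (WithLp.toLp 2 fun l => J.basis.repr
        (a.log - (1 / 2 : ℝ) • ⁅J.yvec y, J.xvec x⁆) (Sum.inr (Sum.inr l)) : Euc d) = x := by
      ext i
      simp [hx, xCoord, J.repr_inr_of_mem (J.lie_yvec_xvec_mem _ _)]
    rw [e1, e2] at h
    change J.zvec (J.zCoord a) + J.yvec y + J.xvec x + _ = _
    exact (sub_eq_iff_eq_add.1 h).symm
  right_inv p := by
    simp only [zCoord_point, yCoord_point, xCoord_point]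

@[simp] theorem coords_symm_apply (p : Euc m × Euc d × Euc d) : J.coords.symm p = J.point p := rfl

@[simp] theorem coords_point (p : Euc m × Euc d × Euc d) : J.coords (J.point p) = p :=
  J.coords.apply_symm_apply p

/-- The coordinates of the central element `[∑ x_i X_i, ∑ y_i Y_i]`. -/
def bracket (x y : Euc d) : Euc m :=
  WithLp.toLp 2 fun l => J.basis.repr ⁅J.xvec x, J.yvec y⁆ (Sum.inl l)

theorem zvec_add (z z' : Euc m) : J.zvec (z + z') = J.zvec z + J.zvec z' := by
  simp [zvec, add_smul, Finset.sum_add_distrib]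

theorem yvec_add (y y' : Euc d) : J.yvec (y + y') = J.yvec y + J.yvec y' := by
  simp [yvec, add_smul, Finset.sum_add_distrib]

theorem xvec_add (x x' : Euc d) : J.xvec (x + x') = J.xvec x + J.xvec x' := by
  simp [xvec, add_smul, Finset.sum_add_distrib]

theorem yvec_smul (c : ℝ) (y : Euc d) : J.yvec (c • y) = c • J.yvec y := by
  simp [yvec, Finset.smul_sum, smul_smul]

theorem zvec_smul (c : ℝ) (y : Euc m) : J.zvec (c • y) = c • J.zvec y := by
  simp [zvec, Finset.smul_sum, smul_smul]

theorem point_mul (p q : Euc m × Euc d × Euc d) : J.point p * J.point q =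
    J.point (p.1 + q.1 + J.bracket p.2.2 q.2.1, p.2.1 + q.2.1, p.2.2 + q.2.2) := by
  ext1
  have hb : J.zvec (J.bracket p.2.2 q.2.1) = ⁅J.xvec p.2.2, J.yvec q.2.1⁆ :=
    J.zvec_repr_of_mem (J.lie_xvec_yvec_mem _ _)
  have hs : ⁅J.yvec q.2.1, J.xvec p.2.2⁆ = - ⁅J.xvec p.2.2, J.yvec q.2.1⁆ := (lie_skew _ _).symm
  simp only [N.log_mul, log_point, zvec_add, yvec_add, xvec_add, hb, add_lie, lie_add, smul_lie,
    lie_smul, lie_of_mem (J.zvec_mem _), lie_of_mem' (J.zvec_mem _), J.lie_yvec, J.lie_xvec,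
    lie_of_mem (J.lie_yvec_xvec_mem _ _), lie_of_mem' (J.lie_yvec_xvec_mem _ _), hs]
  module

/-! #### Haar measure and `L²(N)` -/

/-- The Borel structure of `N` (transported from `ℝ^n` by the coordinates). -/
instance : MeasurableSpace J.N := MeasurableSpace.comap J.coords inferInstance

/-- The coordinates as a measurable equivalence. -/
def coordsM : J.N ≃ᵐ Euc m × Euc d × Euc d where
  toEquiv := J.coords
  measurable_toFun := comap_measurable _
  measurable_invFun := by
    refine measurable_comap_iff.2 ?_
    have : ((J.coords : J.N → Euc m × Euc d × Euc d) ∘ J.coords.symm) = id := by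
      ext1 p; exact J.coords.apply_symm_apply p
    change Measurable ((J.coords : J.N → Euc m × Euc d × Euc d) ∘ J.coords.symm)
    rw [this]
    exact measurable_id

/-- The Haar measure of `N`: Lebesgue measure `dz dy dx` in the coordinates. -/
def haar : Measure J.N := Measure.map J.point volume

theorem measurePreserving_point : MeasurePreserving J.point volume J.haar :=
  ⟨J.coordsM.symm.measurable, rfl⟩

theorem measurePreserving_coords : MeasurePreserving J.coords J.haar volume :=
  MeasurePreserving.symm J.coordsM.symm J.measurePreserving_point

theorem continuous_bracket (x : Euc d) : Continuous (J.bracket x) := by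
  refine (PiLp.continuous_toLp 2 _).comp (continuous_pi fun l => ?_)
  simp only [yvec, lie_sum, lie_smul, map_sum, map_smul, Finsupp.coe_finsetSum,
    Finset.sum_apply, Finsupp.smul_apply, smul_eq_mul]
  fun_prop

/-- The Haar measure is left invariant. -/
theorem measurePreserving_mul_left (a : J.N) : MeasurePreserving (a * ·) J.haar J.haar := by
  obtain ⟨p, rfl⟩ := J.coords.symm.surjective a
  have h1 : MeasurePreserving (fun w : Euc d × Euc d => (p.2.1 + w.1, p.2.2 + w.2))
      volume volume :=
    (measurePreserving_add_left volume p.2.1).prod (measurePreserving_add_left volume p.2.2)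
  have h2 : MeasurePreserving (fun w : (Euc d × Euc d) × Euc m =>
      ((p.2.1 + w.1.1, p.2.2 + w.1.2), p.1 + w.2 + J.bracket p.2.2 w.1.1))
      (volume.prod volume) (volume.prod volume) := by
    refine h1.skew_product (g := fun (w : Euc d × Euc d) (z : Euc m) =>
      p.1 + z + J.bracket p.2.2 w.1) ?_ (Eventually.of_forall fun w => ?_)
    · have := (J.continuous_bracket p.2.2).measurable
      fun_prop
    · have := (measurePreserving_add_left (volume : Measure (Euc m)) (p.1 + J.bracket p.2.2 w.1)).map_eq
      rw [← this]
      congr 1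
      funext z
      abel
  have h3 : MeasurePreserving (fun w : Euc m × Euc d × Euc d =>
      (p.1 + w.1 + J.bracket p.2.2 w.2.1, p.2.1 + w.2.1, p.2.2 + w.2.2)) volume volume :=
    Measure.measurePreserving_swap.comp (h2.comp Measure.measurePreserving_swap)
  convert J.measurePreserving_point.comp (h3.comp J.measurePreserving_coords) using 1
  ext1 b
  obtain ⟨q, rfl⟩ := J.coords.symm.surjective b
  simp [point_mul]

/-- The Hilbert space `L²(N)`. -/
abbrev L2N : Type _ := Lp ℂ 2 J.haar

/-- The left regular representation `(L(a) f)(b) = f(a⁻¹ b)`. -/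
def L (a : J.N) (f : J.L2N) : J.L2N :=
  Lp.compMeasurePreserving (fun b => a⁻¹ * b) (J.measurePreserving_mul_left a⁻¹) f

/-- `Γ = exp (∑ ℤ Z_l) exp (∑ ℤ Y_i) exp (∑ ℤ X_i)`. -/
def Gam : Set J.N :=
  {a | ∃ (k : Fin m → ℤ) (r s : Fin d → ℤ), a = N.exp (∑ l, (k l : ℝ) • J.Z l) *
    N.exp (∑ i, (r i : ℝ) • J.Y i) * N.exp (∑ i, (s i : ℝ) • J.X i)}

/-! #### Dilations -/

/-- The linear map of `𝔫` which is `2` on the `Z_l` and the `Y_i`, and `1` on the `X_i`. -/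
def dilLie : 𝔫 ≃ₗ[ℝ] 𝔫 :=
  J.basis.equiv (J.basis.unitsSMul (Sum.elim (fun _ => Units.mk0 2 two_ne_zero)
    (Sum.elim (fun _ => Units.mk0 2 two_ne_zero) fun _ => 1))) (Equiv.refl _)

theorem dilLie_zvec (z : Euc m) : J.dilLie (J.zvec z) = (2 : ℝ) • J.zvec z := by
  simp [zvec, Z, dilLie, Module.Basis.unitsSMul_apply, Finset.smul_sum, smul_smul, mul_comm,
    Units.smul_def]

theorem dilLie_yvec (y : Euc d) : J.dilLie (J.yvec y) = (2 : ℝ) • J.yvec y := by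
  simp [yvec, Y, dilLie, Module.Basis.unitsSMul_apply, Finset.smul_sum, smul_smul, mul_comm,
    Units.smul_def]

theorem dilLie_xvec (x : Euc d) : J.dilLie (J.xvec x) = J.xvec x := by
  simp [xvec, X, dilLie, Module.Basis.unitsSMul_apply]

theorem dilLie_of_mem {V : 𝔫} (h : V ∈ LieAlgebra.center ℝ 𝔫) : J.dilLie V = (2 : ℝ) • V := by
  rw [← J.zvec_repr_of_mem h, dilLie_zvec]

theorem dilLie_lie (V W : 𝔫) : J.dilLie ⁅V, W⁆ = ⁅J.dilLie V, J.dilLie W⁆ := by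
  rw [J.dilLie_of_mem (J.lie_mem_center V W), J.decomp V, J.decomp W]
  simp only [map_add, dilLie_zvec, dilLie_yvec, dilLie_xvec, add_lie, lie_add, smul_lie, lie_smul,
    lie_of_mem (J.zvec_mem _), lie_of_mem' (J.zvec_mem _), J.lie_yvec, J.lie_xvec]
  module

/-- The automorphism `A` of `N` induced by `dilLie`. -/
def A : MulAut J.N where
  toFun a := N.exp (J.dilLie a.log)
  invFun a := N.exp (J.dilLie.symm a.log)
  left_inv a := by ext; simp
  right_inv a := by ext; simp
  map_mul' a b := by ext; simp [dilLie_lie]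

theorem A_point (p : Euc m × Euc d × Euc d) :
    J.A (J.point p) = J.point ((2 : ℝ) • p.1, (2 : ℝ) • p.2.1, p.2.2) := by
  ext1
  change J.dilLie _ = _
  simp [log_point, zvec_smul, yvec_smul, dilLie_zvec, dilLie_yvec, dilLie_xvec,
    J.dilLie_of_mem (J.lie_yvec_xvec_mem _ _)]

theorem A_zpow_point (j : ℤ) (p : Euc m × Euc d × Euc d) :
    (J.A ^ j) (J.point p) = J.point ((2 : ℝ) ^ j • p.1, (2 : ℝ) ^ j • p.2.1, p.2.2) := by
  induction j generalizing p with
  | zero => simp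
  | succ k ih =>
    rw [zpow_add_one, MulAut.mul_apply, A_point, ih, zpow_add_one₀ two_ne_zero]
    simp [smul_smul]
  | pred k ih =>
    have h : J.point p =
        J.A (J.point ((2 : ℝ)⁻¹ • p.1, (2 : ℝ)⁻¹ • p.2.1, p.2.2)) := by
      rw [A_point]; simp
    rw [zpow_sub_one, MulAut.mul_apply]
    conv_lhs => rw [h]
    rw [MulAut.inv_apply_self, ih, zpow_sub_one₀ two_ne_zero]
    simp [smul_smul]

theorem map_A_zpow (j : ℤ) : Measurable (J.A ^ j : MulAut J.N) ∧
    ∃ c : ℝ≥0∞, c ≠ ∞ ∧ Measure.map (J.A ^ j : MulAut J.N) J.haar = c • J.haar := by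
  have h0 : (2 : ℝ) ^ j ≠ 0 := zpow_ne_zero _ two_ne_zero
  set r : ℝ := (2 : ℝ) ^ j with hr
  have hmeas : Measurable fun w : Euc m × Euc d × Euc d => (r • w.1, r • w.2.1, w.2.2) := by
    fun_prop
  have hfun : ((J.A ^ j : MulAut J.N) : J.N → J.N) = J.point ∘
      (fun w : Euc m × Euc d × Euc d => (r • w.1, r • w.2.1, w.2.2)) ∘ J.coords := by
    ext1 b
    obtain ⟨q, rfl⟩ := J.coords.symm.surjective b
    simp [A_zpow_point, hr]
  have hp := J.measurePreserving_point
  have hc := J.measurePreserving_coords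
  refine ⟨by rw [hfun]; exact hp.measurable.comp (hmeas.comp hc.measurable), ?_⟩
  set c1 : ℝ≥0∞ := ENNReal.ofReal |(r ^ Module.finrank ℝ (Euc m))⁻¹| with hc1
  set c2 : ℝ≥0∞ := ENNReal.ofReal |(r ^ Module.finrank ℝ (Euc d))⁻¹| with hc2
  refine ⟨c1 * c2, ENNReal.mul_ne_top ENNReal.ofReal_ne_top ENNReal.ofReal_ne_top, ?_⟩
  rw [hfun, ← Measure.map_map hp.measurable (hmeas.comp hc.measurable),
    ← Measure.map_map hmeas hc.measurable, hc.map_eq]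
  have hz : Measure.map (r • · : Euc m → Euc m) volume = c1 • volume :=
    Measure.map_addHaar_smul _ h0
  have hy : Measure.map (r • · : Euc d → Euc d) volume = c2 • volume :=
    Measure.map_addHaar_smul _ h0
  have hyx : Measure.map (Prod.map (r • ·) id) (volume : Measure (Euc d × Euc d))
      = c2 • volume := by
    rw [Measure.volume_eq_prod, ← Measure.map_prod_map _ _ (by fun_prop) measurable_id, hy,
      Measure.map_id, Measure.prod_smul_left]
  have hall : Measure.map (Prod.map (r • ·) (Prod.map (r • ·) id))
      (volume : Measure (Euc m × Euc d × Euc d)) = (c1 * c2) • volume := by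
    have : SFinite (Measure.map (Prod.map (r • ·) id) (volume : Measure (Euc d × Euc d))) := by
      rw [hyx]; infer_instance
    rw [Measure.volume_eq_prod, ← Measure.map_prod_map _ _ (by fun_prop) (by fun_prop), hz, hyx,
      Measure.prod_smul_left, Measure.prod_smul_right, smul_smul]
  change Measure.map J.point (Measure.map (Prod.map (r • ·) (Prod.map (r • ·) id)) volume) = _
  rw [hall, Measure.map_smul]
  rfl

theorem memLp_dil (j : ℤ) (f : J.L2N) : MemLp (fun a => (((2 : ℝ) ^ (-(j : ℝ) * (m + d) / 2) : ℝ) : ℂ) *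
    f ((J.A ^ (-j)) a)) 2 J.haar := by
  obtain ⟨hm, c, hc, hmap⟩ := J.map_A_zpow (-j)
  refine MemLp.const_mul ?_ _
  refine MemLp.comp_of_map (g := f) ?_ hm.aemeasurable
  rw [hmap]
  exact (Lp.memLp f).smul_measure hc

/-- The dilation `(D_{A^j} f)(a) = det(Ad_A)^(-j/2) f(A^{-j} a)`; here
`det(Ad_A) = 2 ^ (n - d) = 2 ^ (m + d)`. -/
def D (j : ℤ) (f : J.L2N) : J.L2N := (J.memLp_dil j f).toLp _

/-! #### Representations and the Plancherel transform -/

/-- The linear functional on `𝔫` with `λ(Z_l) = λ_l` and `λ(Y_i) = λ(X_i) = 0`. -/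
def functional (lam : Euc m) : Module.Dual ℝ 𝔫 :=
  J.basis.constr ℝ (Sum.elim (fun l => lam l) fun _ => 0)

/-- The matrix `B(λ) = (λ [X_i, Y_j])`. -/
def B (lam : Euc m) : Matrix (Fin d) (Fin d) ℝ :=
  Matrix.of fun i j => J.functional lam ⁅J.X i, J.Y j⁆

/-- `Σ = {λ : det B(λ) ≠ 0}`. -/
def Sig : Set (Euc m) := {lam | (J.B lam).det ≠ 0}

/-- The Plancherel measure `|det B(λ)| dλ` on `Σ`. -/
def plancherel : Measure (Euc m) :=
  (volume.restrict J.Sig).withDensity fun lam => ENNReal.ofReal |(J.B lam).det|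

/-- `E = ([-1/2, 1/2]^m \ [-1/4, 1/4]^m) ∩ Σ`. -/
def E : Set (Euc m) :=
  ({lam | ∀ l, lam l ∈ Set.Icc (-1 / 2 : ℝ) (1 / 2)} \
    {lam | ∀ l, lam l ∈ Set.Icc (-1 / 4 : ℝ) (1 / 4)}) ∩ J.Sig

/-- The factor `exp (2πi (⟨λ, z⟩ - ⟨t, B(λ) y⟩))`. -/
def phase (lam : Euc m) (a : J.N) (t : Euc d) : ℂ :=
  Complex.exp (2 * Real.pi * Complex.I * ((inner ℝ lam (J.zCoord a) : ℝ) -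
    (inner ℝ t (WithLp.toLp 2 ((J.B lam).mulVec (J.yCoord a).ofLp)) : ℝ)))

theorem norm_phase (lam : Euc m) (a : J.N) (t : Euc d) : ‖J.phase lam a t‖ = 1 := by
  have := Complex.norm_exp_ofReal_mul_I (2 * Real.pi * ((inner ℝ lam (J.zCoord a) : ℝ) -
    (inner ℝ t (WithLp.toLp 2 ((J.B lam).mulVec (J.yCoord a).ofLp)) : ℝ)))
  rw [← this, phase]
  congr 2
  push_cast
  ring

theorem memLp_rep (lam : Euc m) (a : J.N) (φ : L2R d) :
    MemLp (fun t => J.phase lam a t * φ (t - J.xCoord a)) 2 (volume : Measure (Euc d)) := by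
  have h : MemLp (fun t => φ (t - J.xCoord a)) 2 (volume : Measure (Euc d)) :=
    (Lp.memLp φ).comp_measurePreserving (measurePreserving_sub_right volume (J.xCoord a))
  have hph : Continuous (J.phase lam a) := by
    unfold phase; fun_prop
  refine h.mono (hph.aestronglyMeasurable.mul h.1) (Eventually.of_forall fun t => ?_)
  rw [norm_mul, J.norm_phase, one_mul]

/-- The representation `π_λ` of `N` on `L²(ℝ^d)`: for `a = exp (∑ z_l Z_l) exp (∑ y_i Y_i)
exp (∑ x_i X_i)`, `(π_λ(a) φ)(t) = exp (2πi ⟨λ, z⟩) exp (-2πi ⟨t, B(λ) y⟩) φ(t - x)`. -/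
def rep (lam : Euc m) (a : J.N) (φ : L2R d) : L2R d := (J.memLp_rep lam a φ).toLp _

theorem norm_rep (lam : Euc m) (a : J.N) (φ : L2R d) : ‖J.rep lam a φ‖ = ‖φ‖ := by
  rw [rep, Lp.norm_toLp, Lp.norm_def]
  congr 1
  rw [← eLpNorm_comp_measurePreserving (Lp.aestronglyMeasurable φ)
    (measurePreserving_sub_right volume (J.xCoord a))]
  refine eLpNorm_congr_norm_ae (Eventually.of_forall fun t => ?_)
  simp [J.norm_phase]

theorem aestronglyMeasurable_coeff (lam : Euc m) (u v : L2R d) :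
    AEStronglyMeasurable (fun a => inner ℂ v (J.rep lam a u)) J.haar := by
  have hz : Measurable J.zCoord := (measurable_fst.comp J.coordsM.measurable)
  have hy : Measurable J.yCoord := (measurable_fst.comp (measurable_snd.comp J.coordsM.measurable))
  have hx : Measurable J.xCoord := (measurable_snd.comp (measurable_snd.comp J.coordsM.measurable))
  have hph : Measurable fun q : J.N × Euc d => J.phase lam q.1 q.2 := by
    have hB : Measurable fun y : Euc d => (WithLp.toLp 2 ((J.B lam).mulVec y.ofLp) : Euc d) := by
      have : Continuous fun y : Euc d => (WithLp.toLp 2 ((J.B lam).mulVec y.ofLp) : Euc d) := by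
        fun_prop
      exact this.measurable
    have h1 : Measurable fun q : J.N × Euc d => (inner ℝ lam (J.zCoord q.1) : ℝ) :=
      measurable_const.inner (hz.comp measurable_fst)
    have h2 : Measurable fun q : J.N × Euc d =>
        (inner ℝ q.2 (WithLp.toLp 2 ((J.B lam).mulVec (J.yCoord q.1).ofLp) : Euc d) : ℝ) :=
      measurable_snd.inner (hB.comp (hy.comp measurable_fst))
    unfold phase
    fun_prop
  have hu : Measurable u := (Lp.stronglyMeasurable u).measurable
  have hv : Measurable v := (Lp.stronglyMeasurable v).measurable
  have hjoint : Measurable fun q : J.N × Euc d =>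
      inner ℂ (v q.2) (J.phase lam q.1 q.2 * u (q.2 - J.xCoord q.1)) :=
    (hv.comp measurable_snd).inner
      (hph.mul (hu.comp (measurable_snd.sub (hx.comp measurable_fst))))
  have h3 := hjoint.stronglyMeasurable.integral_prod_right' (ν := (volume : Measure (Euc d)))
  refine (h3.aestronglyMeasurable).congr (Eventually.of_forall fun a => ?_)
  simp only [L2.inner_def]
  refine integral_congr_ae ?_
  filter_upwards [(J.memLp_rep lam a u).coeFn_toLp] with t ht
  rw [rep, ht]

theorem integrable_coeff {f : J.N → ℂ} (hf : Integrable f J.haar) (lam : Euc m) (u v : L2R d) :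
    Integrable (fun a => f a * inner ℂ v (J.rep lam a u)) J.haar := by
  refine hf.mul_bdd (c := ‖v‖ * ‖u‖) (J.aestronglyMeasurable_coeff lam u v)
    (Eventually.of_forall fun a => ?_)
  rw [← J.norm_rep lam a u]
  exact norm_inner_le_norm _ _

/-- `T` is the value at `λ` of the Fourier transform of `f ∈ L¹(N)`, in the weak sense
`⟨T u, v⟩ = ∫ f(a) ⟨π_λ(a) u, v⟩ da`. -/
def IsFourierTransform (f : J.N → ℂ) (lam : Euc m) (T : L2R d →L[ℂ] L2R d) : Prop :=
  ∀ u v : L2R d, inner ℂ v (T u) = ∫ a, f a * inner ℂ v (J.rep lam a u) ∂J.haar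

/-- The field `T` represents the Plancherel transform of `f ∈ L²(N)`: it is the limit, in the
direct integral over `Σ` of the Hilbert–Schmidt operators on `L²(ℝ^d)` with respect to the
Plancherel measure, of the Fourier transforms of functions in `L¹(N) ∩ L²(N)` which converge to
`f` in `L²(N)`. -/
def IsPlancherelTransform (f : J.L2N) (T : Euc m → L2R d →L[ℂ] L2R d) : Prop :=
  IsMeasurableField J.plancherel T ∧
  ∃ (g : ℕ → J.L2N) (S : ℕ → Euc m → L2R d →L[ℂ] L2R d),
    (∀ n, Integrable (g n) J.haar) ∧
    (∀ n, IsMeasurableField J.plancherel (S n)) ∧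
    (∀ n, ∀ᵐ lam ∂J.plancherel, J.IsFourierTransform (g n) lam (S n lam)) ∧
    Tendsto g atTop (𝓝 f) ∧
    Tendsto (fun n => ∫⁻ lam, hsNormSq (S n lam - T lam) ∂J.plancherel) atTop (𝓝 0)

theorem IsFourierTransform.add {f g : J.N → ℂ} (hf : Integrable f J.haar)
    (hg : Integrable g J.haar) {lam : Euc m} {S T : L2R d →L[ℂ] L2R d}
    (hS : J.IsFourierTransform f lam S) (hT : J.IsFourierTransform g lam T) :
    J.IsFourierTransform (f + g) lam (S + T) := by
  intro u v
  rw [add_apply, inner_add_right, hS u v, hT u v,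
    ← integral_add (J.integrable_coeff hf lam u v) (J.integrable_coeff hg lam u v)]
  simp only [Pi.add_apply, add_mul]

theorem IsFourierTransform.smul {f : J.N → ℂ} (c : ℂ) {lam : Euc m} {S : L2R d →L[ℂ] L2R d}
    (hS : J.IsFourierTransform f lam S) : J.IsFourierTransform (c • f) lam (c • S) := by
  intro u v
  rw [smul_apply, inner_smul_right, hS u v, ← integral_const_mul]
  simp only [Pi.smul_apply, smul_eq_mul, mul_assoc]

theorem IsFourierTransform.congr {f g : J.N → ℂ} {lam : Euc m} {S : L2R d →L[ℂ] L2R d}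
    (hS : J.IsFourierTransform f lam S) (h : f =ᵐ[J.haar] g) : J.IsFourierTransform g lam S := by
  intro u v
  rw [hS u v]
  refine integral_congr_ae ?_
  filter_upwards [h] with a ha
  rw [ha]

theorem IsPlancherelTransform.add {f g : J.L2N} {S T : Euc m → L2R d →L[ℂ] L2R d}
    (hf : J.IsPlancherelTransform f S) (hg : J.IsPlancherelTransform g T) :
    J.IsPlancherelTransform (f + g) (S + T) := by
  obtain ⟨mS, f', S', if', mS', fS', tf, tS⟩ := hf
  obtain ⟨mT, g', T', ig', mT', fT', tg, tT⟩ := hg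
  refine ⟨mS.add mT, f' + g', S' + T', fun n => ?_, fun n => (mS' n).add (mT' n), fun n => ?_,
    tf.add tg, ?_⟩
  · exact ((if' n).add (ig' n)).congr (Lp.coeFn_add _ _).symm
  · filter_upwards [fS' n, fT' n] with lam h1 h2
    exact (IsFourierTransform.add J (if' n) (ig' n) h1 h2).congr J (Lp.coeFn_add _ _).symm
  · have hlim : Tendsto (fun n => 2 * (∫⁻ lam, hsNormSq (S' n lam - S lam) ∂J.plancherel) +
        2 * ∫⁻ lam, hsNormSq (T' n lam - T lam) ∂J.plancherel) atTop (𝓝 0) := by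
      have := (ENNReal.Tendsto.const_mul tS (Or.inr (ENNReal.ofNat_ne_top (n := 2)))).add
        (ENNReal.Tendsto.const_mul tT (Or.inr (ENNReal.ofNat_ne_top (n := 2))))
      simpa using this
    refine tendsto_of_tendsto_of_tendsto_of_le_of_le tendsto_const_nhds hlim (fun _ => zero_le)
      fun n => ?_
    have a1 : AEMeasurable (fun lam => hsNormSq (S' n lam - S lam)) J.plancherel :=
      ((mS' n).sub mS).aemeasurable_hsNormSq
    have a2 : AEMeasurable (fun lam => hsNormSq (T' n lam - T lam)) J.plancherel :=
      ((mT' n).sub mT).aemeasurable_hsNormSq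
    calc _ ≤ ∫⁻ lam, (2 * hsNormSq (S' n lam - S lam) + 2 * hsNormSq (T' n lam - T lam))
          ∂J.plancherel := by
          refine lintegral_mono fun lam => ?_
          refine le_trans (le_of_eq ?_) (hsNormSq_add_le _ _)
          congr 1
          simp only [Pi.add_apply]
          abel
      _ = _ := by
          rw [lintegral_add_left' (a1.const_mul 2), lintegral_const_mul'' _ a1,
            lintegral_const_mul'' _ a2]

theorem IsPlancherelTransform.smul {f : J.L2N} {S : Euc m → L2R d →L[ℂ] L2R d} (c : ℂ)
    (hf : J.IsPlancherelTransform f S) : J.IsPlancherelTransform (c • f) (c • S) := by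
  obtain ⟨mS, f', S', if', mS', fS', tf, tS⟩ := hf
  refine ⟨mS.smul c, c • f', c • S', fun n => ?_, fun n => (mS' n).smul c, fun n => ?_,
    tf.const_smul c, ?_⟩
  · exact ((if' n).smul c).congr (Lp.coeFn_smul _ _).symm
  · filter_upwards [fS' n] with lam h1
    exact (h1.smul J c).congr J (Lp.coeFn_smul _ _).symm
  · have hlim : Tendsto (fun n => ‖c‖ₑ ^ 2 * ∫⁻ lam, hsNormSq (S' n lam - S lam) ∂J.plancherel)
        atTop (𝓝 0) := by
      have := ENNReal.Tendsto.const_mul tS (Or.inr (ENNReal.pow_ne_top (enorm_ne_top (x := c)) (n := 2)))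
      simpa using this
    refine hlim.congr fun n => ?_
    have a1 : AEMeasurable (fun lam => hsNormSq (S' n lam - S lam)) J.plancherel :=
      ((mS' n).sub mS).aemeasurable_hsNormSq
    rw [← lintegral_const_mul'' _ a1]
    refine lintegral_congr fun lam => ?_
    simp only [Pi.sub_apply, Pi.smul_apply, ← smul_sub, hsNormSq_smul]

theorem IsPlancherelTransform.zero : J.IsPlancherelTransform 0 0 := by
  have hm : IsMeasurableField J.plancherel (0 : Euc m → L2R d →L[ℂ] L2R d) := by
    intro u v; simp
  refine ⟨hm, 0, 0, fun n => ?_, fun n => hm, fun n => ?_, tendsto_const_nhds, ?_⟩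
  · exact (integrable_zero _ _ _).congr (Lp.coeFn_zero _ _ _).symm
  · refine Eventually.of_forall fun lam => ?_
    refine IsFourierTransform.congr J (f := 0) ?_ (Lp.coeFn_zero _ _ _).symm
    intro u v
    simp
  · simp [hsNormSq]

/-- The subspace `H_E^{j,k} = 𝒫⁻¹(∫_{2^{-j}E}^⊕ (L²(ℝ^d) ⊗ e_k) |det B(λ)| dλ)` of `L²(N)`, for the
vector `e = e_k` of `L²(ℝ^d)`: the Plancherel transform vanishes a.e. outside of `2^{-j}E`, and at
almost every `λ ∈ 2^{-j}E` it is of the form `φ ⊗ e`, that is the operator `u ↦ ⟨u, e⟩ φ`. -/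
def HE (e : L2R d) (j : ℤ) : Submodule ℂ J.L2N where
  carrier := {f | ∃ T, J.IsPlancherelTransform f T ∧
    (∀ᵐ lam ∂J.plancherel, lam ∉ ((2 : ℝ) ^ (-j)) • J.E → T lam = 0) ∧
    (∀ᵐ lam ∂J.plancherel, lam ∈ ((2 : ℝ) ^ (-j)) • J.E →
      ∃ φ : L2R d, T lam = InnerProductSpace.rankOne ℂ φ e)}
  zero_mem' := ⟨0, IsPlancherelTransform.zero J, Eventually.of_forall fun _ _ => rfl,
    Eventually.of_forall fun _ _ => ⟨0, by simp⟩⟩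
  add_mem' := by
    rintro f g ⟨S, hS, h1, h2⟩ ⟨T, hT, h3, h4⟩
    refine ⟨S + T, hS.add J hT, ?_, ?_⟩
    · filter_upwards [h1, h3] with lam a b hl
      simp [a hl, b hl]
    · filter_upwards [h2, h4] with lam a b hl
      obtain ⟨φ, hφ⟩ := a hl
      obtain ⟨ψ, hψ⟩ := b hl
      exact ⟨φ + ψ, by simp [hφ, hψ]⟩
  smul_mem' := by
    rintro c f ⟨S, hS, h1, h2⟩
    refine ⟨c • S, hS.smul J c, ?_, ?_⟩
    · filter_upwards [h1] with lam a hl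
      simp [a hl]
    · filter_upwards [h2] with lam a hl
      obtain ⟨φ, hφ⟩ := a hl
      exact ⟨c • φ, by simp [hφ]⟩

end AdaptedBasis

end

/-!
The Plancherel transform is computed explicitly. Let `G` be the Euclidean inverse Fourier transform
of `f ∈ L²(N)` in all the coordinates `(z, y, x)`. Composed with the Fourier transform of `L²(ℝ^d)`,
the operator `∫ f(a) π_λ(a) da` is the integral operator with kernel
`(t, ξ) ↦ G(λ, -B(λ)ᵀ t, ξ) e^{-2πi⟨t, ξ⟩}`; this is `AdaptedBasis.plField`. The substitution
`η = -B(λ)ᵀ t` has Jacobian `|det B(λ)|`, the density of the Plancherel measure, and the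
Hilbert–Schmidt norm of an integral operator is the `L²` norm of its kernel (`hsNormSq_kernelOp`).
So Plancherel's theorem for `N` (`lintegral_hsNormSq_plField`) reduces to the Euclidean one,
surjectivity included (`exists_symbol_eq`). For `f ∈ L¹ ∩ L²` the kernel formula is checked on
Schwartz functions (`integral_symbol_eucIntegral`); hence every field representing the Plancherel
transform of `f` equals `plField f` almost everywhere (`IsPlancherelTransform.ae_eq`).

From here the theorem rests on three facts.

* The set `E` consists of the `λ ∈ Σ` with `1/4 < ‖λ‖_∞ ≤ 1/2`, so the `2^{-j}E` tile `Σ`.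
  Operators `φ ⊗ e_k` with different `k` are Hilbert–Schmidt orthogonal, so the spaces `H_E^{j,k}`
  are pairwise orthogonal (`orthogonalFamily_HE`). By surjectivity every `f ∈ L²(N)` has a
  component in each `H_E^{j,k}` (`exists_component`), so these spaces are total
  (`topologicalClosure_iSup_HE`).
* Since `π_λ ∘ A^j = π_{2^j λ}`, the unitary operator `D_{A^j}` maps `H_E^{0,k}` onto `H_E^{j,k}`
  (`D_mem_HE`, `D_D_neg`), and carries Parseval frames to Parseval frames (`isParsevalFrame_D`).
* Parseval frames of pairwise orthogonal subspaces together form a Parseval frame of the closure of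
  their sum (`IsParsevalFrame.iSup`, `IsParsevalFrame.topologicalClosure`).
-/

noncomputable section

open scoped FourierTransform

/-! ### Parseval frames and Hilbert–Schmidt norms -/

section Frames

variable {H : Type*} [NormedAddCommGroup H] [InnerProductSpace ℂ H]

/-- The coefficients form a vector of `ℓ²` that depends isometrically on the vector of `K`, so the
Parseval identity passes to limits by completeness of `ℓ²`. -/
theorem IsParsevalFrame.topologicalClosure {ι : Type*} {v : ι → H} {K : Submodule ℂ H}
    (h : IsParsevalFrame v K) : IsParsevalFrame v K.topologicalClosure := by
  refine ⟨fun i => K.le_topologicalClosure (h.1 i), fun g hg => ?_⟩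
  have hmem : ∀ g ∈ K, Memℓp (fun i => inner ℂ (v i) g) 2 := fun g hg =>
    memℓp_gen (by simpa using (h.2 g hg).summable)
  have hnorm : ∀ g (hg : g ∈ K), ‖(⟨_, hmem g hg⟩ : lp (fun _ : ι => ℂ) 2)‖ = ‖g‖ := by
    intro g hg
    have h1 := lp.hasSum_norm (p := 2) (by norm_num) (⟨_, hmem g hg⟩ : lp (fun _ : ι => ℂ) 2)
    have h2 := h.2 g hg
    have h3 := h1.unique (f := fun i => ‖inner ℂ (v i) g‖ ^ (2 : ℝ≥0∞).toReal)
      (by simpa using h2)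
    have h4 : ‖(⟨_, hmem g hg⟩ : lp (fun _ : ι => ℂ) 2)‖ ^ 2 = ‖g‖ ^ 2 := by simpa using h3
    exact (pow_left_inj₀ (norm_nonneg _) (norm_nonneg _) two_ne_zero).1 h4
  obtain ⟨x, hxK, hx⟩ := mem_closure_iff_seq_limit.1 (show g ∈ closure (K : Set H) from hg)
  set w : ℕ → lp (fun _ : ι => ℂ) 2 := fun n => ⟨_, hmem (x n) (hxK n)⟩ with hw
  have hdist : ∀ n k, dist (w n) (w k) = dist (x n) (x k) := by
    intro n k
    rw [dist_eq_norm, dist_eq_norm, ← hnorm _ (K.sub_mem (hxK n) (hxK k))]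
    congr 1
    ext i
    exact (inner_sub_right _ _ _).symm
  have hcau : CauchySeq w := by
    have := hx.cauchySeq
    rw [Metric.cauchySeq_iff] at this ⊢
    simpa only [hdist] using this
  obtain ⟨w₀, hw₀⟩ := cauchySeq_tendsto_of_complete hcau
  have hcoord : ∀ i, w₀ i = inner ℂ (v i) g := by
    intro i
    have h1 : Tendsto (fun n => w n i) atTop (𝓝 (w₀ i)) := by
      have h2 := (tendsto_iff_norm_sub_tendsto_zero.1 hw₀)
      refine tendsto_iff_norm_sub_tendsto_zero.2 (squeeze_zero (fun _ => norm_nonneg _)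
        (fun n => ?_) h2)
      exact lp.norm_apply_le_norm (by norm_num) (w n - w₀) i
    exact tendsto_nhds_unique h1 (tendsto_const_nhds.inner hx)
  have hn : ‖w₀‖ = ‖g‖ :=
    tendsto_nhds_unique hw₀.norm (hx.norm.congr fun n => (hnorm _ (hxK n)).symm)
  have h1 := lp.hasSum_norm (p := 2) (by norm_num) w₀
  simpa [hcoord, hn] using h1

theorem IsParsevalFrame.iSup {ι P : Type*} {K : P → Submodule ℂ H}
    (hK : OrthogonalFamily ℂ (fun p => K p) fun p => (K p).subtypeₗᵢ) {v : P → ι → H}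
    (hv : ∀ p, IsParsevalFrame (v p) (K p)) :
    IsParsevalFrame (fun q : P × ι => v q.1 q.2) (⨆ p, K p) := by
  refine ⟨fun q => Submodule.mem_iSup_of_mem q.1 ((hv q.1).1 q.2), fun g hg => ?_⟩
  obtain ⟨l, hl, rfl⟩ := (Submodule.mem_iSup_iff_exists_finsupp _ _).1 hg
  have hin : ∀ p i, inner ℂ (v p i) (l.sum fun _ x => x) = inner ℂ (v p i) (l p) := by
    intro p i
    rw [Finsupp.sum, inner_sum]
    refine (Finset.sum_eq_single p (fun q _ hq => ?_) fun hp => ?_)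
    · exact hK hq.symm ⟨_, (hv p).1 i⟩ ⟨_, hl q⟩
    · rw [Finsupp.notMem_support_iff.1 hp, inner_zero_right]
  have hnorm : ‖l.sum fun _ x => x‖ ^ 2 = ∑ p ∈ l.support, ‖l p‖ ^ 2 := by
    have := hK.norm_sum (fun p => (⟨l p, hl p⟩ : K p)) l.support
    simpa [Finsupp.sum] using this
  have hfib : ∀ p, HasSum (fun i => ‖inner ℂ (v p i) (l.sum fun _ x => x)‖ ^ 2) (‖l p‖ ^ 2) := by
    intro p
    simp only [hin]
    exact (hv p).2 _ (hl p)
  have hout : HasSum (fun p => ‖l p‖ ^ 2) (∑ p ∈ l.support, ‖l p‖ ^ 2) :=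
    hasSum_sum_of_ne_finset_zero fun p hp => by simp [Finsupp.notMem_support_iff.1 hp]
  have hsum : Summable fun q : P × ι => ‖inner ℂ (v q.1 q.2) (l.sum fun _ x => x)‖ ^ 2 := by
    refine (summable_prod_of_nonneg fun _ => by positivity).2 ⟨fun p => (hfib p).summable, ?_⟩
    simp only [(hfib _).tsum_eq]
    exact hout.summable
  rw [hnorm]
  have := hsum.hasSum.prod_fiberwise hfib
  rw [hout.unique this]
  exact hsum.hasSum

end Frames

section HilbertSchmidt

variable {H : Type*} [NormedAddCommGroup H] [InnerProductSpace ℂ H] [CompleteSpace H]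

theorem hsNormSq_eq_zero_iff {T : H →L[ℂ] H} : hsNormSq T = 0 ↔ T = 0 := by
  refine ⟨fun h => ?_, fun h => by simp [h, hsNormSq]⟩
  rw [hsNormSq, ENNReal.tsum_eq_zero] at h
  refine ContinuousLinearMap.ext_on (s := Set.range (someBasis H)) ?_ ?_
  · rw [Submodule.dense_iff_topologicalClosure_eq_top]
    exact (someBasis H).dense_span
  · rintro _ ⟨i, rfl⟩
    simpa using h i

theorem hsNormSq_comp_linearIsometryEquiv (T : H →L[ℂ] H) (U : H ≃ₗᵢ[ℂ] H) :
    hsNormSq (T ∘L (U.toContinuousLinearEquiv : H →L[ℂ] H)) = hsNormSq T := by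
  classical
  let b : HilbertBasis _ ℂ H := HilbertBasis.ofRepr (U.trans (someBasis H).repr)
  have hb : ∀ i, U (b i) = someBasis H i := by
    intro i
    rw [← b.repr_symm_single i, ← (someBasis H).repr_symm_single i]
    exact U.apply_symm_apply _
  rw [hsNormSq_eq b, hsNormSq]
  exact tsum_congr fun i => by simp [hb]

/-- Hilbert–Schmidt orthogonality, in the form needed for the operators `φ ⊗ e`: two operators of
which at most one is nonzero on each member of an orthonormal basis. -/
theorem hsNormSq_add_of_basis {ι : Type*} (b : HilbertBasis ι ℂ H) {S T : H →L[ℂ] H}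
    (h : ∀ i, S (b i) = 0 ∨ T (b i) = 0) : hsNormSq (S + T) = hsNormSq S + hsNormSq T := by
  rw [hsNormSq_eq b, hsNormSq_eq b, hsNormSq_eq b, ← ENNReal.tsum_add]
  refine tsum_congr fun i => ?_
  rcases h i with h | h <;> simp [h]

theorem hsNormSq_sub_le (S T : H →L[ℂ] H) :
    hsNormSq (S - T) ≤ 2 * hsNormSq S + 2 * hsNormSq T := by
  have h := hsNormSq_add_le S ((-1 : ℂ) • T)
  rwa [hsNormSq_smul, enorm_neg, enorm_one, one_pow, one_mul, neg_one_smul, ← sub_eq_add_neg] at h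

end HilbertSchmidt

/-! ### Integral operators with square integrable kernel -/

section SquareIntegrable

variable {α E : Type*} [MeasurableSpace α] {μ : Measure α} [NormedAddCommGroup E]

theorem eLpNorm_two_sq (f : α → E) : eLpNorm f 2 μ ^ 2 = ∫⁻ x, ‖f x‖ₑ ^ 2 ∂μ := by
  have := eLpNorm_nnreal_pow_eq_lintegral (f := f) (μ := μ) (p := 2) two_ne_zero
  simpa only [NNReal.coe_ofNat, ENNReal.rpow_ofNat, ENNReal.coe_ofNat] using this

theorem memLp_two_iff_lintegral {f : α → E} :
    MemLp f 2 μ ↔ AEStronglyMeasurable f μ ∧ ∫⁻ x, ‖f x‖ₑ ^ 2 ∂μ < ∞ := by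
  rw [MemLp, ← eLpNorm_two_sq, ENNReal.pow_lt_top_iff]
  simp

theorem enorm_toLp_two_sq {f : α → E} (hf : MemLp f 2 μ) :
    ‖hf.toLp f‖ₑ ^ 2 = ∫⁻ x, ‖f x‖ₑ ^ 2 ∂μ := by
  rw [Lp.enorm_toLp, eLpNorm_two_sq]

theorem enorm_Lp_two_sq (f : Lp E 2 μ) : ‖f‖ₑ ^ 2 = ∫⁻ x, ‖f x‖ₑ ^ 2 ∂μ := by
  rw [Lp.enorm_def, eLpNorm_two_sq]

theorem MeasureTheory.MemLp.conj {f : α → ℂ} (hf : MemLp f 2 μ) :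
    MemLp (fun x => starRingEnd ℂ (f x)) 2 μ := hf.star

/-- Integration against a square integrable function is an inner product. -/
theorem integral_mul_eq_inner {f : α → ℂ} (hf : MemLp f 2 μ) (w : Lp ℂ 2 μ) :
    ∫ x, f x * w x ∂μ = inner ℂ (hf.conj.toLp _) w := by
  rw [L2.inner_def]
  refine integral_congr_ae ?_
  filter_upwards [hf.conj.coeFn_toLp] with x hx
  simp [hx, mul_comm]

theorem enorm_toLp_conj_sq {f : α → ℂ} (hf : MemLp f 2 μ) :
    ‖hf.conj.toLp _‖ₑ ^ 2 = ∫⁻ x, ‖f x‖ₑ ^ 2 ∂μ := by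
  rw [enorm_toLp_two_sq]
  refine lintegral_congr fun x => ?_
  rw [← ofReal_norm, ← ofReal_norm, RCLike.norm_conj]

theorem MeasureTheory.MemLp.two_mul_prod {β : Type*} [MeasurableSpace β] {ν : Measure β} [SFinite ν]
    {f : α → ℂ} {g : β → ℂ} (hf : MemLp f 2 μ) (hg : MemLp g 2 ν) :
    MemLp (fun p : α × β => f p.1 * g p.2) 2 (μ.prod ν) := by
  rw [memLp_two_iff_lintegral] at *
  refine ⟨hf.1.comp_fst.mul hg.1.comp_snd, ?_⟩
  simp only [enorm_mul, mul_pow]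
  rw [lintegral_prod_mul (hf.1.enorm.pow_const 2) (hg.1.enorm.pow_const 2)]
  exact ENNReal.mul_lt_top hf.2 hg.2

end SquareIntegrable

section Kernel

variable {α : Type*} [MeasurableSpace α] {μ : Measure α} [SFinite μ]

theorem ae_memLp_section {β : Type*} [MeasurableSpace β] {ν : Measure β} [SFinite ν]
    {M : β × α → ℂ} (hM : MemLp M 2 (ν.prod μ)) :
    ∀ᵐ t ∂ν, MemLp (fun ξ => M (t, ξ)) 2 μ := by
  rw [memLp_two_iff_lintegral] at hM
  have h1 := hM.2
  rw [lintegral_prod _ (hM.1.enorm.pow_const 2)] at h1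
  filter_upwards [hM.1.prodMk_left, ae_lt_top' (hM.1.enorm.pow_const 2).lintegral_prod_right' h1.ne]
    with t h2 h3
  exact memLp_two_iff_lintegral.2 ⟨h2, h3⟩

theorem memLp_kernel {M : α × α → ℂ} (hM : MemLp M 2 (μ.prod μ)) (w : Lp ℂ 2 μ) :
    MemLp (fun t => ∫ ξ, M (t, ξ) * w ξ ∂μ) 2 μ ∧
      ∫⁻ t, ‖∫ ξ, M (t, ξ) * w ξ ∂μ‖ₑ ^ 2 ∂μ ≤ (∫⁻ p, ‖M p‖ₑ ^ 2 ∂(μ.prod μ)) * ‖w‖ₑ ^ 2 := by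
  have hle : ∫⁻ t, ‖∫ ξ, M (t, ξ) * w ξ ∂μ‖ₑ ^ 2 ∂μ
      ≤ (∫⁻ p, ‖M p‖ₑ ^ 2 ∂(μ.prod μ)) * ‖w‖ₑ ^ 2 := by
    rw [lintegral_prod _ (hM.1.enorm.pow_const 2), ← lintegral_mul_const''
      _ (hM.1.enorm.pow_const 2).lintegral_prod_right']
    refine lintegral_mono_ae ?_
    filter_upwards [ae_memLp_section hM] with t ht
    rw [integral_mul_eq_inner ht, ← enorm_toLp_conj_sq ht, ← mul_pow]
    refine pow_le_pow_left' ?_ 2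
    simp only [enorm_eq_nnnorm, ← ENNReal.coe_mul, ENNReal.coe_le_coe]
    exact nnnorm_inner_le_nnnorm _ _
  refine ⟨memLp_two_iff_lintegral.2 ⟨?_, hle.trans_lt (ENNReal.mul_lt_top
    (memLp_two_iff_lintegral.1 hM).2 (by simp))⟩, hle⟩
  exact (hM.1.mul (Lp.aestronglyMeasurable w).comp_snd).integral_prod_right'

/-- The integral operator `(R w)(t) = ∫ M(t, ξ) w(ξ) dξ` with square integrable kernel `M`. -/
def kernelOp {M : α × α → ℂ} (hM : MemLp M 2 (μ.prod μ)) : Lp ℂ 2 μ →L[ℂ] Lp ℂ 2 μ :=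
  LinearMap.mkContinuous
    { toFun w := (memLp_kernel hM w).1.toLp _
      map_add' w w' := by
        rw [← MemLp.toLp_add, MemLp.toLp_eq_toLp_iff]
        filter_upwards [ae_memLp_section hM] with t ht
        simp only [integral_mul_eq_inner ht, inner_add_right, Pi.add_apply]
      map_smul' c w := by
        rw [← MemLp.toLp_const_smul, MemLp.toLp_eq_toLp_iff]
        filter_upwards [ae_memLp_section hM] with t ht
        simp only [integral_mul_eq_inner ht, inner_smul_right, Pi.smul_apply, smul_eq_mul,
          RingHom.id_apply] }
    ‖hM.toLp M‖ (fun w => by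
      have h := (memLp_kernel hM w).2
      rw [← enorm_toLp_two_sq hM, ← enorm_toLp_two_sq (memLp_kernel hM w).1, ← mul_pow] at h
      have h2 := (ENNReal.pow_right_strictMono two_ne_zero).le_iff_le.1 h
      simp only [enorm_eq_nnnorm, ← ENNReal.coe_mul, ENNReal.coe_le_coe] at h2
      exact_mod_cast h2)

theorem kernelOp_apply {M : α × α → ℂ} (hM : MemLp M 2 (μ.prod μ)) (w : Lp ℂ 2 μ) :
    kernelOp hM w =ᵐ[μ] fun t => ∫ ξ, M (t, ξ) * w ξ ∂μ :=
  (memLp_kernel hM w).1.coeFn_toLp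

theorem integrable_kernel {M : α × α → ℂ} (hM : MemLp M 2 (μ.prod μ)) (v w : Lp ℂ 2 μ) :
    Integrable (fun p : α × α => M p * (starRingEnd ℂ (v p.1) * w p.2)) (μ.prod μ) :=
  hM.integrable_mul (MemLp.two_mul_prod (Lp.memLp v).conj (Lp.memLp w))

theorem inner_kernelOp {M : α × α → ℂ} (hM : MemLp M 2 (μ.prod μ)) (v w : Lp ℂ 2 μ) :
    inner ℂ v (kernelOp hM w)
      = ∫ p, M p * (starRingEnd ℂ (v p.1) * w p.2) ∂(μ.prod μ) := by
  rw [integral_prod _ (integrable_kernel hM v w), L2.inner_def]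
  refine integral_congr_ae ?_
  filter_upwards [kernelOp_apply hM w] with t ht
  rw [ht, RCLike.inner_apply, mul_comm, ← integral_const_mul]
  refine integral_congr_ae (Eventually.of_forall fun ξ => ?_)
  simp only
  ring

theorem kernelOp_congr {M M' : α × α → ℂ} (hM : MemLp M 2 (μ.prod μ))
    (hM' : MemLp M' 2 (μ.prod μ)) (h : M =ᵐ[μ.prod μ] M') : kernelOp hM = kernelOp hM' := by
  ext1 w
  refine ext_inner_left ℂ fun v => ?_
  rw [inner_kernelOp, inner_kernelOp]
  refine integral_congr_ae ?_
  filter_upwards [h] with p hp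
  rw [hp]

theorem kernelOp_add {M M' : α × α → ℂ} (hM : MemLp M 2 (μ.prod μ))
    (hM' : MemLp M' 2 (μ.prod μ)) : kernelOp (hM.add hM') = kernelOp hM + kernelOp hM' := by
  ext1 w
  refine ext_inner_left ℂ fun v => ?_
  rw [add_apply, inner_add_right, inner_kernelOp, inner_kernelOp, inner_kernelOp,
    ← integral_add (integrable_kernel hM v w) (integrable_kernel hM' v w)]
  simp only [Pi.add_apply, add_mul]

theorem kernelOp_smul {M : α × α → ℂ} (c : ℂ) (hM : MemLp M 2 (μ.prod μ)) :
    kernelOp (hM.const_smul c) = c • kernelOp hM := by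
  ext1 w
  refine ext_inner_left ℂ fun v => ?_
  rw [smul_apply, inner_smul_right, inner_kernelOp, inner_kernelOp, ← integral_const_mul]
  simp only [Pi.smul_apply, smul_eq_mul, mul_assoc]

/-- A product kernel `φ(t) conj(c(ξ))` defines the rank one operator `φ ⊗ c`. -/
theorem kernelOp_mul {φ : α → ℂ} (hφ : MemLp φ 2 μ) (c : Lp ℂ 2 μ) :
    kernelOp (MemLp.two_mul_prod hφ (Lp.memLp c).conj)
      = InnerProductSpace.rankOne ℂ (hφ.toLp φ) c := by
  ext1 w
  refine Lp.ext ?_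
  rw [InnerProductSpace.rankOne_apply]
  filter_upwards [kernelOp_apply (MemLp.two_mul_prod hφ (Lp.memLp c).conj) w,
    Lp.coeFn_smul (inner ℂ c w) (hφ.toLp φ), hφ.coeFn_toLp] with t h1 h2 h3
  rw [h1, h2, Pi.smul_apply, h3, smul_eq_mul, mul_comm, L2.inner_def, ← integral_const_mul]
  refine integral_congr_ae (Eventually.of_forall fun ξ => ?_)
  simp only [RCLike.inner_apply]
  ring

/-- The Hilbert–Schmidt norm of an integral operator is the `L²` norm of its kernel: by Parseval
on each section `M(t, ·)`, and Tonelli. -/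
theorem hsNormSq_kernelOp [TopologicalSpace.SeparableSpace (Lp ℂ 2 μ)] {M : α × α → ℂ}
    (hM : MemLp M 2 (μ.prod μ)) :
    hsNormSq (kernelOp hM) = ∫⁻ p, ‖M p‖ₑ ^ 2 ∂(μ.prod μ) := by
  have := countable_of_hilbertBasis (someBasis (Lp ℂ 2 μ))
  set b := someBasis (Lp ℂ 2 μ) with hb
  have h1 : ∀ i, ‖kernelOp hM (b i)‖ₑ ^ 2 = ∫⁻ t, ‖∫ ξ, M (t, ξ) * b i ξ ∂μ‖ₑ ^ 2 ∂μ :=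
    fun i => enorm_toLp_two_sq (memLp_kernel hM (b i)).1
  rw [hsNormSq]
  simp only [← hb, h1]
  rw [← lintegral_tsum fun i => (memLp_kernel hM (b i)).1.1.enorm.pow_const 2,
    lintegral_prod _ (hM.1.enorm.pow_const 2)]
  refine lintegral_congr_ae ?_
  filter_upwards [ae_memLp_section hM] with t ht
  simp only [integral_mul_eq_inner ht, ← enorm_toLp_conj_sq ht]
  rw [enorm_sq_eq_tsum b]
  refine tsum_congr fun i => ?_
  rw [← inner_conj_symm, ← ofReal_norm, ← ofReal_norm, RCLike.norm_conj]

end Kernel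

/-! ### The Euclidean Fourier transform of `L²(N)` -/

section FourierL2

variable {V : Type*} [NormedAddCommGroup V] [InnerProductSpace ℝ V] [FiniteDimensional ℝ V]
  [MeasurableSpace V] [BorelSpace V]

theorem continuous_fourierInv_of_integrable {f : V → ℂ} (hf : Integrable f) :
    Continuous (𝓕⁻ f) :=
  VectorFourier.fourierIntegral_continuous Real.continuous_fourierChar
    (show Continuous fun p : V × V => -inner ℝ p.1 p.2 from continuous_inner.neg) hf

open scoped ContDiff in
/-- On `L¹ ∩ L²` the inverse Fourier transform of `L²` is given by the Fourier integral: both sides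
pair in the same way with test functions. -/
theorem fourierInv_Lp_ae_eq (f : Lp ℂ 2 (volume : Measure V)) (hf : Integrable f) :
    (𝓕⁻ f : Lp ℂ 2 (volume : Measure V)) =ᵐ[volume] 𝓕⁻ (f : V → ℂ) := by
  refine ae_eq_of_integral_contDiff_smul_eq ((Lp.memLp _).locallyIntegrable (by norm_num))
    (continuous_fourierInv_of_integrable hf).locallyIntegrable fun g hg1 hg2 => ?_
  have hg₁ : HasCompactSupport (Complex.ofRealCLM ∘ g) := hg2.comp_left rfl
  have hg₂ : ContDiff ℝ ∞ (Complex.ofRealCLM ∘ g) := by fun_prop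
  set G : SchwartzMap V ℂ := hg₁.toSchwartzMap hg₂ with hG
  have hGg : ∀ x, G x = (g x : ℂ) := fun x => rfl
  have h1 := congrArg (fun T => T G) (Lp.fourierInv_toTemperedDistribution_eq f)
  simp only [TemperedDistribution.fourierInv_apply, Lp.toTemperedDistribution_apply,
    SchwartzMap.fourierInv_coe] at h1
  have h2 := VectorFourier.integral_fourierIntegral_smul_eq_flip (L := -innerₗ V)
    (μ := volume) (ν := volume) Real.continuous_fourierChar
    (show Continuous fun p : V × V => -inner ℝ p.1 p.2 from continuous_inner.neg) hf G.integrable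
  have h3 : (-innerₗ V).flip = -innerₗ V := by
    ext x y
    simp [real_inner_comm]
  rw [h3] at h2
  calc ∫ x, g x • (𝓕⁻ f : Lp ℂ 2 (volume : Measure V)) x
      = ∫ x, G x • (𝓕⁻ f : Lp ℂ 2 (volume : Measure V)) x := by
        refine integral_congr_ae (Eventually.of_forall fun x => ?_)
        simp [hGg]
    _ = ∫ x, (𝓕⁻ (G : V → ℂ)) x • f x := h1.symm
    _ = ∫ x, f x • (𝓕⁻ (G : V → ℂ)) x := by simp only [smul_eq_mul, mul_comm]
    _ = ∫ x, (𝓕⁻ (f : V → ℂ)) x • G x := h2.symm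
    _ = ∫ x, g x • 𝓕⁻ (f : V → ℂ) x := by
        refine integral_congr_ae (Eventually.of_forall fun x => ?_)
        simp [hGg, mul_comm]

end FourierL2

/-- The isometry of `L²` spaces induced by a measure preserving measurable equivalence. -/
def lpEquiv {α β : Type*} [MeasurableSpace α] [MeasurableSpace β] {μ : Measure α} {ν : Measure β}
    (e : α ≃ᵐ β) (he : MeasurePreserving e μ ν) : Lp ℂ 2 ν ≃ₗᵢ[ℂ] Lp ℂ 2 μ :=
  LinearIsometryEquiv.ofSurjective (Lp.compMeasurePreservingₗᵢ ℂ e he) fun f => by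
    refine ⟨Lp.compMeasurePreserving e.symm (he.symm e) f, ?_⟩
    refine Lp.ext ?_
    have h1 := Lp.coeFn_compMeasurePreserving (Lp.compMeasurePreserving e.symm (he.symm e) f) he
    have h2 := he.quasiMeasurePreserving.ae
      (Lp.coeFn_compMeasurePreserving f (he.symm e))
    filter_upwards [h1, h2] with x h1 h2
    refine h1.trans ?_
    rw [Function.comp_apply, h2]
    simp

theorem lpEquiv_ae {α β : Type*} [MeasurableSpace α] [MeasurableSpace β] {μ : Measure α}
    {ν : Measure β} (e : α ≃ᵐ β) (he : MeasurePreserving e μ ν) (f : Lp ℂ 2 ν) :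
    lpEquiv e he f =ᵐ[μ] f ∘ e :=
  Lp.coeFn_compMeasurePreserving f he

/-- The Euclidean space of the triples `(z, y, x)`. -/
abbrev EucTriple (m d : ℕ) : Type := WithLp 2 (Euc m × WithLp 2 (Euc d × Euc d))

/-- Triples, as elements of Euclidean space. -/
def tripleEquiv (m d : ℕ) : Euc m × Euc d × Euc d ≃ᵐ EucTriple m d :=
  ((MeasurableEquiv.refl _).prodCongr (MeasurableEquiv.toLp 2 _)).trans (MeasurableEquiv.toLp 2 _)

theorem measurePreserving_tripleEquiv (m d : ℕ) :
    MeasurePreserving (tripleEquiv m d) volume volume :=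
  (WithLp.volume_preserving_toLp (Euc m) (WithLp 2 (Euc d × Euc d))).comp
    ((MeasurePreserving.id volume).prod (WithLp.volume_preserving_toLp (Euc d) (Euc d)))

theorem inner_tripleEquiv {m d : ℕ} (p q : Euc m × Euc d × Euc d) :
    inner ℝ (tripleEquiv m d p) (tripleEquiv m d q)
      = inner ℝ p.1 q.1 + (inner ℝ p.2.1 q.2.1 + inner ℝ p.2.2 q.2.2) := rfl

namespace AdaptedBasis

variable {𝔫 : Type*} [LieRing 𝔫] [LieAlgebra ℝ 𝔫] {m d : ℕ} (J : AdaptedBasis 𝔫 m d)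

theorem measurePreserving_coordsM : MeasurePreserving J.coordsM J.haar volume :=
  J.measurePreserving_coords

/-- The Euclidean inverse Fourier transform of `L²(N)` in all the coordinates. -/
def eucFourier : J.L2N ≃ₗᵢ[ℂ] Lp ℂ 2 (volume : Measure (Euc m × Euc d × Euc d)) :=
  ((lpEquiv J.coordsM J.measurePreserving_coordsM).symm.trans
    (lpEquiv (tripleEquiv m d) (measurePreserving_tripleEquiv m d)).symm).trans
  ((Lp.fourierTransformₗᵢ (EucTriple m d) ℂ).symm.trans
    (lpEquiv (tripleEquiv m d) (measurePreserving_tripleEquiv m d)))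

/-- The pairing of the coordinates of `a` with the frequency `q`. -/
def pairing (a : J.N) (q : Euc m × Euc d × Euc d) : ℝ :=
  inner ℝ (J.zCoord a) q.1 + (inner ℝ (J.yCoord a) q.2.1 + inner ℝ (J.xCoord a) q.2.2)

/-- The Fourier integral defining the Euclidean inverse Fourier transform of `f ∈ L¹(N)`. -/
def eucIntegral (f : J.N → ℂ) (q : Euc m × Euc d × Euc d) : ℂ :=
  ∫ a, Complex.exp (2 * Real.pi * Complex.I * J.pairing a q) * f a ∂J.haar

theorem eucFourier_ae (f : J.L2N) (hf : Integrable f J.haar) :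
    J.eucFourier f =ᵐ[volume] J.eucIntegral f := by
  set e1 := lpEquiv J.coordsM J.measurePreserving_coordsM
  set e2 := lpEquiv (tripleEquiv m d) (measurePreserving_tripleEquiv m d)
  set f1 := e1.symm f with hf1
  set f2 := e2.symm f1 with hf2
  set E := J.coordsM.trans (tripleEquiv m d) with hE
  have hEm : MeasurePreserving E J.haar volume :=
    (measurePreserving_tripleEquiv m d).comp J.measurePreserving_coordsM
  have h1 : f =ᵐ[J.haar] f2 ∘ E := by
    have a1 : f = e1 f1 := by simp [hf1]
    have a2 : f1 = e2 f2 := by simp [hf2]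
    have b1 : e1 f1 =ᵐ[J.haar] f1 ∘ J.coordsM := lpEquiv_ae _ _ _
    have b2 : e2 f2 =ᵐ[volume] f2 ∘ tripleEquiv m d := lpEquiv_ae _ _ _
    have b3 := J.measurePreserving_coordsM.quasiMeasurePreserving.ae b2
    filter_upwards [b1, b3] with a c1 c3
    rw [a1, c1, Function.comp_apply, a2, c3]
    rfl
  have hint : Integrable f2 volume := by
    rw [← hEm.integrable_comp_emb E.measurableEmbedding]
    exact hf.congr h1
  have h2 : J.eucFourier f = e2 (𝓕⁻ f2) := rfl
  have h3 : e2 (𝓕⁻ f2) =ᵐ[volume] (𝓕⁻ f2 : Lp ℂ 2 _) ∘ tripleEquiv m d := lpEquiv_ae _ _ _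
  have h4 := (measurePreserving_tripleEquiv m d).quasiMeasurePreserving.ae
    (fourierInv_Lp_ae_eq f2 hint)
  rw [h2]
  filter_upwards [h3, h4] with q h3 h4
  rw [h3, Function.comp_apply, h4, Real.fourierInv_eq', eucIntegral,
    ← hEm.integral_comp E.measurableEmbedding]
  refine integral_congr_ae ?_
  filter_upwards [h1] with a ha
  rw [ha, smul_eq_mul, Function.comp_apply]
  congr 2
  have : inner ℝ (E a) (tripleEquiv m d q) = J.pairing a q := inner_tripleEquiv _ _
  rw [this]
  push_cast
  ring

end AdaptedBasis

/-! ### The frequencies and the Plancherel measure -/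

namespace AdaptedBasis

variable {𝔫 : Type*} [LieRing 𝔫] [LieAlgebra ℝ 𝔫] {m d : ℕ} (J : AdaptedBasis 𝔫 m d)

theorem functional_apply (lam : Euc m) (V : 𝔫) :
    J.functional lam V = ∑ l, lam l * J.basis.repr V (Sum.inl l) := by
  rw [functional, Module.Basis.constr_apply_fintype, Fintype.sum_sum_type]
  simp [mul_comm]

theorem B_apply (lam : Euc m) (i j : Fin d) :
    J.B lam i j = ∑ l, lam l * J.basis.repr ⁅J.X i, J.Y j⁆ (Sum.inl l) :=
  J.functional_apply lam _

theorem B_add (lam nu : Euc m) : J.B (lam + nu) = J.B lam + J.B nu := by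
  ext i j
  simp [B_apply, add_mul, Finset.sum_add_distrib]

theorem B_smul (c : ℝ) (lam : Euc m) : J.B (c • lam) = c • J.B lam := by
  ext i j
  simp [B_apply, mul_assoc, Finset.mul_sum]

theorem continuous_B : Continuous J.B := by
  refine continuous_matrix fun i j => ?_
  simp only [B_apply]
  fun_prop

theorem measurableSet_Sig : MeasurableSet J.Sig :=
  (isOpen_ne.preimage J.continuous_B.matrix_det).measurableSet

theorem smul_mem_Sig {c : ℝ} (hc : c ≠ 0) {lam : Euc m} : c • lam ∈ J.Sig ↔ lam ∈ J.Sig := by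
  simp [Sig, B_smul, hc]

theorem exists_mem_Sig : ∃ lam, lam ∈ J.Sig := by
  obtain ⟨f, hf⟩ := J.det_ne_zero
  refine ⟨WithLp.toLp 2 fun l => f (J.Z l), ?_⟩
  rw [Sig, Set.mem_ofPred_eq]
  convert hf using 2
  ext i j
  have h := J.lie_X_Y i j
  have h2 := congrArg f (J.zvec_repr_of_mem h)
  rw [zvec, map_sum] at h2
  rw [B_apply, Matrix.of_apply, ← h2]
  exact Finset.sum_congr rfl fun l _ => by simp [X, Y, mul_comm]

/-- Along every line with a direction in `Σ` the determinant is a nonzero polynomial, hence has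
finitely many zeros; so its zero set is a null set. -/
theorem ae_mem_Sig : ∀ᵐ lam : Euc m, lam ∈ J.Sig := by
  obtain ⟨v, hv⟩ := J.exists_mem_Sig
  refine ae_mem_of_ae_add_linearMap_mem (LinearMap.toSpanSingleton ℝ (Euc m) v) volume volume
    J.measurableSet_Sig fun lam => ?_
  set p : Polynomial ℝ := ((Polynomial.X : Polynomial ℝ) • (J.B v).map Polynomial.C
    + (J.B lam).map Polynomial.C).det with hp
  have hp0 : p ≠ 0 := by
    intro h0
    apply hv
    rw [← Polynomial.coeff_det_X_add_C_card (J.B v) (J.B lam), ← hp, h0, Polynomial.coeff_zero]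
  have hfin : {s : ℝ | p.eval s = 0}.Finite := by
    refine (p.roots.toFinset.finite_toSet).subset fun s hs => ?_
    simpa [hp0] using hs
  refine measure_mono_null (fun s hs => ?_) (hfin.measure_zero volume)
  have heval : p.eval s = (J.B (lam + s • v)).det := by
    rw [hp, ← Polynomial.coe_evalRingHom, RingHom.map_det, B_add, B_smul, add_comm]
    congr 1
    ext i j
    simp
    ring
  have hs' : ¬ (J.B (lam + s • v)).det ≠ 0 := hs
  exact heval.trans (not_not.1 hs')

/-- The linear map `t ↦ -B(λ)ᵀ t`, which gives the `y`-frequency at the point `t` of the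
oscillating factor of `π_λ`. -/
def freqLin (lam : Euc m) : Euc d →ₗ[ℝ] Euc d := Matrix.toEuclideanLin (-(J.B lam).transpose)

theorem inner_freqLin (lam : Euc m) (y t : Euc d) :
    inner ℝ y (J.freqLin lam t) = -inner ℝ t (WithLp.toLp 2 ((J.B lam).mulVec y.ofLp)) := by
  simp only [freqLin, Matrix.toLpLin_apply, EuclideanSpace.inner_eq_star_dotProduct,
    star_trivial, Matrix.neg_mulVec, neg_dotProduct, Matrix.mulVec_transpose]
  rw [← Matrix.dotProduct_mulVec, dotProduct_comm]

theorem det_freqLin (lam : Euc m) : |LinearMap.det (J.freqLin lam)| = |(J.B lam).det| := by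
  rw [freqLin, LinearMap.det_toLpLin, Matrix.det_neg, Matrix.det_transpose, abs_mul, abs_pow]
  simp

theorem continuous_freqLin : Continuous fun p : Euc m × Euc d => J.freqLin p.1 p.2 := by
  refine (PiLp.continuous_toLp 2 _).comp ?_
  have h1 : Continuous fun p : Euc m × Euc d => -(J.B p.1).transpose :=
    (J.continuous_B.comp continuous_fst).matrix_transpose.neg
  exact h1.matrix_mulVec (by fun_prop)

theorem measurable_freqMap : Measurable fun q : Euc m × Euc d × Euc d =>
    (q.1, J.freqLin q.1 q.2.1, q.2.2) := by
  have h : Continuous fun q : Euc m × Euc d × Euc d => J.freqLin q.1 q.2.1 :=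
    J.continuous_freqLin.comp (f := fun q : Euc m × Euc d × Euc d => (q.1, q.2.1)) (by fun_prop)
  have h2 : Continuous fun q : Euc m × Euc d × Euc d => (q.1, J.freqLin q.1 q.2.1, q.2.2) := by
    fun_prop
  exact h2.measurable

/-- The change of coordinates `(λ, t, ξ) ↦ (λ, -B(λ)ᵀ t, ξ)` transports the Plancherel measure times
Lebesgue measure to Lebesgue measure. -/
theorem lintegral_plancherel {F : Euc m × Euc d × Euc d → ℝ≥0∞} (hF : Measurable F) :
    ∫⁻ lam, ∫⁻ p : Euc d × Euc d, F (lam, J.freqLin lam p.1, p.2) ∂(volume.prod volume)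
      ∂J.plancherel = ∫⁻ q, F q := by
  have hFm : Measurable fun q : Euc m × Euc d × Euc d => F (q.1, J.freqLin q.1 q.2.1, q.2.2) :=
    hF.comp J.measurable_freqMap
  have hdet : Measurable fun lam => ENNReal.ofReal |(J.B lam).det| :=
    (J.continuous_B.matrix_det.measurable.abs).ennreal_ofReal
  have hin : Measurable fun lam => ∫⁻ p : Euc d × Euc d, F (lam, J.freqLin lam p.1, p.2)
      ∂(volume.prod volume) := hFm.lintegral_prod_right'
  rw [plancherel, lintegral_withDensity_eq_lintegral_mul _ hdet hin]
  have hSig : volume.restrict J.Sig = (volume : Measure (Euc m)) :=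
    Measure.restrict_eq_self_of_ae_mem J.ae_mem_Sig
  rw [hSig, Measure.volume_eq_prod (Euc m), lintegral_prod _ hF.aemeasurable]
  refine lintegral_congr_ae ?_
  filter_upwards [J.ae_mem_Sig] with lam hlam
  have hd : LinearMap.det (J.freqLin lam) ≠ 0 := by
    rw [← abs_ne_zero, det_freqLin, abs_ne_zero]; exact hlam
  have hsec : Measurable fun p : Euc d × Euc d => F (lam, J.freqLin lam p.1, p.2) :=
    hFm.comp measurable_prodMk_left
  have hsec' : Measurable fun p : Euc d × Euc d => F (lam, p) := hF.comp measurable_prodMk_left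
  rw [Pi.mul_apply, lintegral_prod _ hsec.aemeasurable, Measure.volume_eq_prod (Euc d),
    lintegral_prod _ hsec'.aemeasurable]
  have hmap := Measure.map_linearMap_addHaar_eq_smul_addHaar (volume : Measure (Euc d)) hd
  have hcont : Measurable (J.freqLin lam) :=
    (J.freqLin lam).continuous_of_finiteDimensional.measurable
  have h1 := lintegral_map (μ := (volume : Measure (Euc d)))
    (f := fun η => ∫⁻ ξ, F (lam, η, ξ)) hsec'.lintegral_prod_right' hcont
  rw [hmap, lintegral_smul_measure] at h1
  rw [← h1, smul_eq_mul, ← mul_assoc, abs_inv, det_freqLin, ← ENNReal.ofReal_mul (abs_nonneg _),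
    mul_inv_cancel₀ (abs_ne_zero.2 hlam), ENNReal.ofReal_one, one_mul]

theorem ae_plancherel_of_ae {P : Euc m → Prop} (h : ∀ᵐ lam, P lam) : ∀ᵐ lam ∂J.plancherel, P lam :=
  (withDensity_absolutelyContinuous _ _).ae_le (ae_restrict_of_ae h)

/-- A property of almost every frequency holds along the change of coordinates
`(λ, t, ξ) ↦ (λ, -B(λ)ᵀ t, ξ)`. -/
theorem ae_ae_freqLin {P : Euc m × Euc d × Euc d → Prop} (h : ∀ᵐ q, P q) :
    ∀ᵐ lam ∂J.plancherel, ∀ᵐ p : Euc d × Euc d ∂(volume.prod volume),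
      P (lam, J.freqLin lam p.1, p.2) := by
  obtain ⟨s, hs, hsm, hs0⟩ := exists_measurable_superset_of_null (ae_iff.1 h)
  have h1 := J.lintegral_plancherel (F := s.indicator 1) (measurable_one.indicator hsm)
  rw [lintegral_indicator_one hsm, hs0] at h1
  have hFm : Measurable fun q : Euc m × Euc d × Euc d =>
      s.indicator (1 : Euc m × Euc d × Euc d → ℝ≥0∞) (q.1, J.freqLin q.1 q.2.1, q.2.2) :=
    (measurable_one.indicator hsm).comp J.measurable_freqMap
  rw [lintegral_eq_zero_iff hFm.lintegral_prod_right'] at h1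
  filter_upwards [h1] with lam hlam
  have hsec : Measurable fun p : Euc d × Euc d =>
      s.indicator (1 : Euc m × Euc d × Euc d → ℝ≥0∞) (lam, J.freqLin lam p.1, p.2) :=
    hFm.comp measurable_prodMk_left
  rw [Pi.zero_apply, lintegral_eq_zero_iff hsec] at hlam
  filter_upwards [hlam] with p hp
  by_contra hP
  have : (lam, J.freqLin lam p.1, p.2) ∈ s := hs hP
  simp [Set.indicator_of_mem this] at hp

instance : SFinite J.plancherel := by unfold plancherel; infer_instance

instance : SigmaFinite J.haar := by
  have : SigmaFinite (Measure.map J.coordsM.symm volume) := J.coordsM.symm.sigmaFinite_map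
  exact this

end AdaptedBasis

/-! ### The Plancherel transform as a field of integral operators -/

namespace AdaptedBasis

variable {𝔫 : Type*} [LieRing 𝔫] [LieAlgebra ℝ 𝔫] {m d : ℕ} (J : AdaptedBasis 𝔫 m d)

/-- The character `exp (-2πi ⟨t, ξ⟩)`. -/
def char (t ξ : Euc d) : ℂ := Complex.exp (-(2 * Real.pi * Complex.I * (inner ℝ t ξ : ℝ)))

theorem norm_char (t ξ : Euc d) : ‖char t ξ‖ = 1 := by
  have := Complex.norm_exp_ofReal_mul_I (-(2 * Real.pi * inner ℝ t ξ))
  rw [← this, char]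
  congr 2
  push_cast
  ring

theorem enorm_char (t ξ : Euc d) : ‖char t ξ‖ₑ = 1 := by
  rw [← ofReal_norm, norm_char, ENNReal.ofReal_one]

theorem continuous_char : Continuous fun p : Euc d × Euc d => char p.1 p.2 := by
  unfold char
  fun_prop

/-- The kernel at `λ` obtained from a function `G` of the frequencies: the Plancherel transform of
`f` at `λ`, composed with the Fourier transform, has this kernel when `G` is the Euclidean inverse
Fourier transform of `f`. -/
def symbol (G : Euc m × Euc d × Euc d → ℂ) (lam : Euc m) (p : Euc d × Euc d) : ℂ :=
  G (lam, J.freqLin lam p.1, p.2) * char p.1 p.2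

theorem measurable_symbol {G : Euc m × Euc d × Euc d → ℂ} (hG : Measurable G) :
    Measurable fun q : Euc m × Euc d × Euc d => J.symbol G q.1 q.2 :=
  (hG.comp J.measurable_freqMap).mul (continuous_char.measurable.comp measurable_snd)

theorem enorm_symbol (G : Euc m × Euc d × Euc d → ℂ) (lam : Euc m) (p : Euc d × Euc d) :
    ‖J.symbol G lam p‖ₑ = ‖G (lam, J.freqLin lam p.1, p.2)‖ₑ := by
  rw [symbol, enorm_mul, enorm_char, mul_one]

theorem lintegral_symbol {G : Euc m × Euc d × Euc d → ℂ} (hG : Measurable G) :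
    ∫⁻ lam, ∫⁻ p, ‖J.symbol G lam p‖ₑ ^ 2 ∂(volume.prod volume) ∂J.plancherel
      = ∫⁻ q, ‖G q‖ₑ ^ 2 := by
  simp only [enorm_symbol]
  exact J.lintegral_plancherel (hG.enorm.pow_const 2)

theorem symbol_congr {G G' : Euc m × Euc d × Euc d → ℂ} (h : G =ᵐ[volume] G') :
    ∀ᵐ lam ∂J.plancherel, J.symbol G lam =ᵐ[volume.prod volume] J.symbol G' lam := by
  filter_upwards [J.ae_ae_freqLin h] with lam hlam
  filter_upwards [hlam] with p hp
  rw [symbol, symbol, hp]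

theorem measurable_eucFourier (f : J.L2N) : Measurable (J.eucFourier f) :=
  (Lp.stronglyMeasurable _).measurable

theorem lintegral_symbol_eucFourier (f : J.L2N) :
    ∫⁻ lam, ∫⁻ p, ‖J.symbol (J.eucFourier f) lam p‖ₑ ^ 2 ∂(volume.prod volume) ∂J.plancherel
      = ‖f‖ₑ ^ 2 := by
  rw [lintegral_symbol _ (J.measurable_eucFourier f), ← enorm_Lp_two_sq]
  congr 1
  rw [← ofReal_norm, ← ofReal_norm, LinearIsometryEquiv.norm_map]

theorem ae_memLp_symbol (f : J.L2N) :
    ∀ᵐ lam ∂J.plancherel, MemLp (J.symbol (J.eucFourier f) lam) 2 (volume.prod volume) := by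
  have hm := J.measurable_symbol (J.measurable_eucFourier f)
  have h := J.lintegral_symbol_eucFourier f
  have hlt : ∫⁻ lam, ∫⁻ p, ‖J.symbol (J.eucFourier f) lam p‖ₑ ^ 2 ∂(volume.prod volume)
      ∂J.plancherel ≠ ∞ := by
    rw [h]; exact ENNReal.pow_ne_top enorm_ne_top
  have hm2 : Measurable fun q : Euc m × Euc d × Euc d =>
      ‖J.symbol (J.eucFourier f) q.1 q.2‖ₑ ^ 2 := hm.enorm.pow_const 2
  filter_upwards [ae_lt_top hm2.lintegral_prod_right' hlt] with lam hlam
  exact memLp_two_iff_lintegral.2 ⟨(hm.comp measurable_prodMk_left).aestronglyMeasurable, hlam⟩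

open Classical in
/-- The Plancherel transform of `f ∈ L²(N)`, as an explicit field of Hilbert–Schmidt operators. It
is set to `0` at the null set of the `λ` at which the kernel is not square integrable. -/
def plField (f : J.L2N) (lam : Euc m) : L2R d →L[ℂ] L2R d :=
  if h : MemLp (J.symbol (J.eucFourier f) lam) 2 (volume.prod volume) then
    kernelOp h ∘L ((Lp.fourierTransformₗᵢ (Euc d) ℂ).symm.toContinuousLinearEquiv :
      L2R d →L[ℂ] L2R d) else 0

theorem plField_eq {f : J.L2N} {lam : Euc m}
    (h : MemLp (J.symbol (J.eucFourier f) lam) 2 (volume.prod volume)) :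
    J.plField f lam = kernelOp h ∘L
      ((Lp.fourierTransformₗᵢ (Euc d) ℂ).symm.toContinuousLinearEquiv : L2R d →L[ℂ] L2R d) :=
  dif_pos h

/-- Plancherel's formula. -/
theorem lintegral_hsNormSq_plField (f : J.L2N) :
    ∫⁻ lam, hsNormSq (J.plField f lam) ∂J.plancherel = ‖f‖ₑ ^ 2 := by
  rw [← lintegral_symbol_eucFourier]
  refine lintegral_congr_ae ?_
  filter_upwards [J.ae_memLp_symbol f] with lam h
  rw [J.plField_eq h, hsNormSq_comp_linearIsometryEquiv, hsNormSq_kernelOp]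

theorem isMeasurableField_plField (f : J.L2N) : IsMeasurableField J.plancherel (J.plField f) := by
  intro u v
  set w : L2R d := (Lp.fourierTransformₗᵢ (Euc d) ℂ).symm u with hw
  have hu : Measurable w := (Lp.stronglyMeasurable w).measurable
  have hv : Measurable v := (Lp.stronglyMeasurable v).measurable
  have hm : Measurable fun q : Euc m × Euc d × Euc d => J.symbol (J.eucFourier f) q.1 q.2 *
      (starRingEnd ℂ (v q.2.1) * w q.2.2) := by
    refine (J.measurable_symbol (J.measurable_eucFourier f)).mul (Measurable.mul ?_ ?_)
    · exact (continuous_star.measurable.comp hv).comp (measurable_fst.comp measurable_snd)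
    · exact hu.comp (measurable_snd.comp measurable_snd)
  refine (hm.stronglyMeasurable.integral_prod_right' (ν := volume.prod volume)).measurable
    |>.aemeasurable.congr ?_
  filter_upwards [J.ae_memLp_symbol f] with lam h
  rw [J.plField_eq h]
  exact (inner_kernelOp h v w).symm

theorem plField_add (f g : J.L2N) :
    ∀ᵐ lam ∂J.plancherel, J.plField (f + g) lam = J.plField f lam + J.plField g lam := by
  have h0 : J.eucFourier (f + g) =ᵐ[volume] J.eucFourier f + J.eucFourier g := by
    rw [map_add]; exact Lp.coeFn_add _ _
  filter_upwards [J.ae_memLp_symbol f, J.ae_memLp_symbol g, J.ae_memLp_symbol (f + g),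
    J.symbol_congr h0] with lam h1 h2 h3 h4
  rw [J.plField_eq h1, J.plField_eq h2, J.plField_eq h3, ← ContinuousLinearMap.add_comp,
    ← kernelOp_add]
  congr 1
  refine kernelOp_congr _ _ (h4.trans (Eventually.of_forall fun p => ?_))
  simp [symbol, add_mul]

theorem plField_smul (c : ℂ) (f : J.L2N) :
    ∀ᵐ lam ∂J.plancherel, J.plField (c • f) lam = c • J.plField f lam := by
  have h0 : J.eucFourier (c • f) =ᵐ[volume] c • ⇑(J.eucFourier f) := by
    rw [map_smul]; exact Lp.coeFn_smul _ _
  filter_upwards [J.ae_memLp_symbol f, J.ae_memLp_symbol (c • f), J.symbol_congr h0]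
    with lam h1 h2 h3
  rw [J.plField_eq h1, J.plField_eq h2, ← ContinuousLinearMap.smul_comp, ← kernelOp_smul]
  congr 1
  refine kernelOp_congr _ _ (h3.trans (Eventually.of_forall fun p => ?_))
  simp [symbol, mul_assoc]

theorem plField_sub (f g : J.L2N) :
    ∀ᵐ lam ∂J.plancherel, J.plField (f - g) lam = J.plField f lam - J.plField g lam := by
  have h := J.plField_add f ((-1 : ℂ) • g)
  rw [neg_one_smul, ← sub_eq_add_neg] at h
  have h2 := J.plField_smul (-1) g
  rw [neg_one_smul] at h2
  filter_upwards [h, h2] with lam h h2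
  rw [h, h2, neg_one_smul, ← sub_eq_add_neg]

/-! ### The Fourier transform of integrable functions -/

theorem rep_sub (lam : Euc m) (a : J.N) (u u' : L2R d) :
    J.rep lam a (u - u') = J.rep lam a u - J.rep lam a u' := by
  rw [rep, rep, rep, ← MemLp.toLp_sub, MemLp.toLp_eq_toLp_iff]
  have h := (measurePreserving_sub_right (volume : Measure (Euc d))
    (J.xCoord a)).quasiMeasurePreserving.ae (Lp.coeFn_sub u u')
  filter_upwards [h] with t ht
  simp only [ht, Pi.sub_apply, mul_sub]

theorem continuous_rep (lam : Euc m) (a : J.N) : Continuous (J.rep lam a) := by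
  refine (Isometry.of_dist_eq fun u u' => ?_).continuous
  rw [dist_eq_norm, dist_eq_norm, ← rep_sub, norm_rep]

theorem continuous_integral_coeff {f : J.N → ℂ} (hf : Integrable f J.haar) (lam : Euc m) :
    Continuous fun p : L2R d × L2R d => ∫ a, f a * inner ℂ p.2 (J.rep lam a p.1) ∂J.haar := by
  refine continuous_iff_continuousAt.2 fun p => ?_
  refine tendsto_integral_filter_of_dominated_convergence
    (fun a => ‖f a‖ * ((‖p.2‖ + 1) * (‖p.1‖ + 1)))
    (Eventually.of_forall fun q => (J.integrable_coeff hf lam q.1 q.2).1) ?_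
    (hf.norm.mul_const _) (Eventually.of_forall fun a => ?_)
  · have h1 : ∀ᶠ q : L2R d × L2R d in 𝓝 p, ‖q.1‖ < ‖p.1‖ + 1 :=
      (continuous_fst.norm.tendsto p).eventually_lt_const (by linarith)
    have h2 : ∀ᶠ q : L2R d × L2R d in 𝓝 p, ‖q.2‖ < ‖p.2‖ + 1 :=
      (continuous_snd.norm.tendsto p).eventually_lt_const (by linarith)
    filter_upwards [h1, h2] with q h1 h2
    refine Eventually.of_forall fun a => ?_
    rw [norm_mul]
    gcongr
    refine (norm_inner_le_norm _ _).trans ?_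
    rw [norm_rep]
    gcongr
  · have : Continuous fun q : L2R d × L2R d => f a * inner ℂ q.2 (J.rep lam a q.1) :=
      continuous_const.mul (continuous_snd.inner ((J.continuous_rep lam a).comp continuous_fst))
    exact this.tendsto p

end AdaptedBasis

/-! ### Identification of the Plancherel transform -/

namespace AdaptedBasis

variable {𝔫 : Type*} [LieRing 𝔫] [LieAlgebra ℝ 𝔫] {m d : ℕ} (J : AdaptedBasis 𝔫 m d)

theorem norm_exp_pairing (a : J.N) (q : Euc m × Euc d × Euc d) :
    ‖Complex.exp (2 * Real.pi * Complex.I * J.pairing a q)‖ = 1 := by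
  have := Complex.norm_exp_ofReal_mul_I (2 * Real.pi * J.pairing a q)
  rw [← this]
  congr 2
  push_cast
  ring

theorem measurable_pairing (lam : Euc m) :
    Measurable fun r : (Euc d × Euc d) × J.N =>
      J.pairing r.2 (lam, J.freqLin lam r.1.1, r.1.2) := by
  have hz : Measurable J.zCoord := (measurable_fst.comp J.coordsM.measurable)
  have hy : Measurable J.yCoord := (measurable_fst.comp (measurable_snd.comp J.coordsM.measurable))
  have hx : Measurable J.xCoord := (measurable_snd.comp (measurable_snd.comp J.coordsM.measurable))
  have hcont : Measurable (J.freqLin lam) :=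
    (J.freqLin lam).continuous_of_finiteDimensional.measurable
  unfold pairing
  refine Measurable.add ?_ (Measurable.add ?_ ?_)
  · exact (hz.comp measurable_snd).inner measurable_const
  · exact (hy.comp measurable_snd).inner (hcont.comp (measurable_fst.comp measurable_fst))
  · have h : Measurable fun r : (Euc d × Euc d) × J.N => r.1.2 :=
      measurable_snd.comp measurable_fst
    exact (hx.comp measurable_snd).inner h

/-- The phases in the kernel `e^{2πi⟨a, (λ, -B(λ)ᵀt, ξ)⟩} e^{-2πi⟨t, ξ⟩}` recombine to the
oscillating factor of `π_λ(a)` times the character `e^{-2πi⟨ξ, t - x⟩}`. -/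
theorem exp_pairing_mul_char (lam : Euc m) (a : J.N) (t ξ : Euc d) :
    Complex.exp (2 * Real.pi * Complex.I * J.pairing a (lam, J.freqLin lam t, ξ)) * char t ξ
      = J.phase lam a t *
        Complex.exp (((-2 * Real.pi * inner ℝ ξ (t - J.xCoord a) : ℝ) : ℂ) * Complex.I) := by
  rw [char, phase, ← Complex.exp_add, ← Complex.exp_add]
  congr 1
  simp only [pairing, inner_freqLin, inner_sub_right]
  rw [real_inner_comm lam, real_inner_comm ξ t, real_inner_comm ξ (J.xCoord a)]
  push_cast
  ring

/-- The hypothesis of Fubini's theorem in `integral_symbol_eucIntegral`. -/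
theorem integrable_kernel_integrand (lam : Euc m) {f : J.N → ℂ} (hf : Integrable f J.haar)
    (v w : SchwartzMap (Euc d) ℂ) :
    Integrable (fun r : (Euc d × Euc d) × J.N =>
      (Complex.exp (2 * Real.pi * Complex.I * J.pairing r.2 (lam, J.freqLin lam r.1.1, r.1.2)) *
        char r.1.1 r.1.2) * ((starRingEnd ℂ (v r.1.1) * w r.1.2) * f r.2))
      ((volume.prod volume).prod J.haar) := by
  have h1 : Integrable (fun p : Euc d × Euc d => starRingEnd ℂ (v p.1) * w p.2)
      (volume.prod volume) :=
    Integrable.mul_prod (Complex.conjLIE.integrable_comp_iff.2 v.integrable) w.integrable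
  have hmeas : Measurable fun r : (Euc d × Euc d) × J.N =>
      (Complex.exp (2 * Real.pi * Complex.I * J.pairing r.2 (lam, J.freqLin lam r.1.1, r.1.2)) *
        char r.1.1 r.1.2) := by
    have := J.measurable_pairing lam
    refine Measurable.mul (by fun_prop) (continuous_char.measurable.comp measurable_fst)
  refine (h1.mul_prod hf).bdd_mul (c := 1) hmeas.aestronglyMeasurable
    (Eventually.of_forall fun r => ?_)
  rw [norm_mul, norm_exp_pairing, norm_char, one_mul]

/-- The matrix coefficient of `π_λ(a)` as a double integral over position and frequency. -/
theorem integral_eq_inner_rep (lam : Euc m) (a : J.N) (v w : SchwartzMap (Euc d) ℂ) :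
    ∫ p : Euc d × Euc d,
      (Complex.exp (2 * Real.pi * Complex.I * J.pairing a (lam, J.freqLin lam p.1, p.2)) *
        char p.1 p.2) * (starRingEnd ℂ (v p.1) * w p.2) ∂(volume.prod volume)
      = inner ℂ (v.toLp 2) (J.rep lam a ((𝓕 w).toLp 2)) := by
  have h1 : Integrable (fun p : Euc d × Euc d => starRingEnd ℂ (v p.1) * w p.2)
      (volume.prod volume) :=
    Integrable.mul_prod (Complex.conjLIE.integrable_comp_iff.2 v.integrable) w.integrable
  have hmeas : Measurable fun p : Euc d × Euc d =>
      (Complex.exp (2 * Real.pi * Complex.I * J.pairing a (lam, J.freqLin lam p.1, p.2)) *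
        char p.1 p.2) := by
    have hp : Measurable fun p : Euc d × Euc d => (p, a) := measurable_prodMk_right
    have h := (J.measurable_pairing lam).comp hp
    simp only [Function.comp_def] at h
    exact Measurable.mul (by fun_prop) continuous_char.measurable
  have h2 : Integrable (fun p : Euc d × Euc d =>
      (Complex.exp (2 * Real.pi * Complex.I * J.pairing a (lam, J.freqLin lam p.1, p.2)) *
        char p.1 p.2) * (starRingEnd ℂ (v p.1) * w p.2)) (volume.prod volume) :=
    h1.bdd_mul (c := 1) hmeas.aestronglyMeasurable (Eventually.of_forall fun r => by
      rw [norm_mul, norm_exp_pairing, norm_char, one_mul])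
  rw [integral_prod _ h2, L2.inner_def]
  refine integral_congr_ae ?_
  have h3 := (measurePreserving_sub_right (volume : Measure (Euc d))
    (J.xCoord a)).quasiMeasurePreserving.ae ((𝓕 w).coeFn_toLp 2 volume)
  filter_upwards [v.coeFn_toLp 2 volume, (J.memLp_rep lam a ((𝓕 w).toLp 2)).coeFn_toLp, h3]
    with t e1 e2 e3
  rw [e1, rep, e2, e3, SchwartzMap.fourier_coe, Real.fourier_eq', RCLike.inner_apply,
    ← integral_const_mul, ← integral_mul_const]
  refine integral_congr_ae (Eventually.of_forall fun ξ => ?_)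
  simp only [exp_pairing_mul_char, smul_eq_mul]
  ring

/-- The kernel formula for the Fourier transform of `f ∈ L¹(N)`, tested on Schwartz functions. -/
theorem integral_symbol_eucIntegral (lam : Euc m) {f : J.N → ℂ} (hf : Integrable f J.haar)
    (v w : SchwartzMap (Euc d) ℂ) :
    ∫ p, J.symbol (J.eucIntegral f) lam p * (starRingEnd ℂ (v p.1) * w p.2) ∂(volume.prod volume)
      = ∫ a, f a * inner ℂ (v.toLp 2) (J.rep lam a ((𝓕 w).toLp 2)) ∂J.haar := by
  have h := integral_integral_swap (μ := volume.prod volume) (ν := J.haar)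
    (f := fun (p : Euc d × Euc d) (a : J.N) =>
      (Complex.exp (2 * Real.pi * Complex.I * J.pairing a (lam, J.freqLin lam p.1, p.2)) *
        char p.1 p.2) * ((starRingEnd ℂ (v p.1) * w p.2) * f a))
    (J.integrable_kernel_integrand lam hf v w)
  calc _ = _ := ?_
    _ = _ := h
    _ = _ := ?_
  · refine integral_congr_ae (Eventually.of_forall fun p => ?_)
    simp only [symbol, eucIntegral]
    rw [mul_assoc, ← integral_mul_const]
    refine integral_congr_ae (Eventually.of_forall fun a => ?_)
    simp only
    ring
  · refine integral_congr_ae (Eventually.of_forall fun a => ?_)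
    simp only
    rw [← integral_eq_inner_rep, ← integral_const_mul]
    refine integral_congr_ae (Eventually.of_forall fun p => ?_)
    simp only
    ring

theorem denseRange_schwartz (d : ℕ) :
    DenseRange fun w : SchwartzMap (Euc d) ℂ => (w.toLp 2 : L2R d) :=
  SchwartzMap.denseRange_toLpCLM ENNReal.ofNat_ne_top

theorem isFourierTransform_plField (f : J.L2N) (hf : Integrable f J.haar) :
    ∀ᵐ lam ∂J.plancherel, J.IsFourierTransform f lam (J.plField f lam) := by
  filter_upwards [J.ae_memLp_symbol f, J.symbol_congr (J.eucFourier_ae f hf)] with lam h1 h2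
  set T := J.plField f lam with hT
  have hcont1 : Continuous fun p : L2R d × L2R d => inner ℂ p.2 (T p.1) :=
    continuous_snd.inner (T.continuous.comp continuous_fst)
  have hcont2 := J.continuous_integral_coeff hf lam
  have hdense : DenseRange fun p : SchwartzMap (Euc d) ℂ × SchwartzMap (Euc d) ℂ =>
      (((𝓕 p.1).toLp 2, p.2.toLp 2) : L2R d × L2R d) := by
    have h3 : DenseRange fun w : SchwartzMap (Euc d) ℂ => ((𝓕 w).toLp 2 : L2R d) := by
      simp only [← SchwartzMap.toLp_fourier_eq]
      exact (Lp.fourierTransformₗᵢ (Euc d) ℂ).surjective.denseRange.comp (denseRange_schwartz d)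
        (Lp.fourierTransformₗᵢ (Euc d) ℂ).continuous
    exact h3.prodMap (denseRange_schwartz d)
  -- Both sides are jointly continuous in the two vectors, so Schwartz functions suffice.
  have heq := hdense.equalizer hcont1 hcont2 (funext fun p => by
    obtain ⟨w, v⟩ := p
    simp only [Function.comp_apply]
    have h4 : (Lp.fourierTransformₗᵢ (Euc d) ℂ).symm ((𝓕 w).toLp 2) = (w.toLp 2 : L2R d) := by
      rw [← SchwartzMap.toLp_fourier_eq]
      exact (Lp.fourierTransformₗᵢ (Euc d) ℂ).symm_apply_apply _
    have h5 : T ((𝓕 w).toLp 2) = kernelOp h1 (w.toLp 2) := by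
      rw [hT, J.plField_eq h1, ← h4]
      rfl
    rw [h5, inner_kernelOp, ← integral_symbol_eucIntegral J lam hf]
    refine integral_congr_ae ?_
    have e1 := Measure.quasiMeasurePreserving_fst (μ := (volume : Measure (Euc d)))
      (ν := (volume : Measure (Euc d))) |>.ae (v.coeFn_toLp 2 volume)
    have e2 := Measure.quasiMeasurePreserving_snd (μ := (volume : Measure (Euc d)))
      (ν := (volume : Measure (Euc d))) |>.ae (w.coeFn_toLp 2 volume)
    filter_upwards [h2, e1, e2] with p h2 e1 e2
    rw [h2, e1, e2])
  intro u v
  exact congrFun heq (u, v)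

theorem IsFourierTransform.unique {f : J.N → ℂ} {lam : Euc m} {S T : L2R d →L[ℂ] L2R d}
    (hS : J.IsFourierTransform f lam S) (hT : J.IsFourierTransform f lam T) : S = T := by
  ext1 u
  exact ext_inner_left ℂ fun v => (hS u v).trans (hT u v).symm

theorem exists_integrable_tendsto (f : J.L2N) :
    ∃ g : ℕ → J.L2N, (∀ n, Integrable (g n) J.haar) ∧ Tendsto g atTop (𝓝 f) := by
  have hd : DenseRange ((↑) : Lp.simpleFunc ℂ 2 J.haar → J.L2N) :=
    Lp.simpleFunc.denseRange (by norm_num)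
  obtain ⟨x, hx, hlim⟩ := mem_closure_iff_seq_limit.1 (hd f)
  refine ⟨x, fun n => ?_, hlim⟩
  obtain ⟨s, hs⟩ := hx n
  rw [← hs]
  have h1 := Lp.simpleFunc.toSimpleFunc_eq_toFun s
  refine Integrable.congr ?_ h1
  exact (SimpleFunc.memLp_iff_integrable (by norm_num) (by norm_num)).1 (Lp.simpleFunc.memLp s)

theorem tendsto_lintegral_hsNormSq_plField {g : ℕ → J.L2N} {f : J.L2N}
    (h : Tendsto g atTop (𝓝 f)) :
    Tendsto (fun n => ∫⁻ lam, hsNormSq (J.plField (g n) lam - J.plField f lam) ∂J.plancherel)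
      atTop (𝓝 0) := by
  have h1 : ∀ n, ∫⁻ lam, hsNormSq (J.plField (g n) lam - J.plField f lam) ∂J.plancherel
      = ‖g n - f‖ₑ ^ 2 := fun n => by
    rw [← lintegral_hsNormSq_plField]
    refine lintegral_congr_ae ?_
    filter_upwards [J.plField_sub (g n) f] with lam h
    rw [h]
  simp only [h1]
  have h2 : Tendsto (fun n => g n - f) atTop (𝓝 0) := by
    simpa using h.sub_const f
  have h3 := (continuous_enorm.tendsto (0 : J.L2N)).comp h2
  rw [enorm_zero] at h3
  simpa using ENNReal.Tendsto.pow (n := 2) h3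

theorem isPlancherelTransform_plField (f : J.L2N) : J.IsPlancherelTransform f (J.plField f) := by
  obtain ⟨g, hg, hlim⟩ := J.exists_integrable_tendsto f
  exact ⟨J.isMeasurableField_plField f, g, fun n => J.plField (g n), hg,
    fun n => J.isMeasurableField_plField (g n), fun n => J.isFourierTransform_plField (g n) (hg n),
    hlim, J.tendsto_lintegral_hsNormSq_plField hlim⟩

/-- The Plancherel transform is unique, so that it is given by the explicit field of operators. -/
theorem IsPlancherelTransform.ae_eq {f : J.L2N} {T : Euc m → L2R d →L[ℂ] L2R d}
    (h : J.IsPlancherelTransform f T) : ∀ᵐ lam ∂J.plancherel, T lam = J.plField f lam := by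
  obtain ⟨hT, g, S, hg, hS, hFT, hlim, hST⟩ := h
  have hSg : ∀ n, ∀ᵐ lam ∂J.plancherel, S n lam = J.plField (g n) lam := fun n => by
    filter_upwards [hFT n, J.isFourierTransform_plField (g n) (hg n)] with lam h1 h2
    exact IsFourierTransform.unique J h1 h2
  have hP := J.isMeasurableField_plField f
  -- Both fields are limits of the same sequence in the Hilbert–Schmidt norm.
  have hzero : ∫⁻ lam, hsNormSq (T lam - J.plField f lam) ∂J.plancherel = 0 := by
    have hle : ∀ n, ∫⁻ lam, hsNormSq (T lam - J.plField f lam) ∂J.plancherel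
        ≤ 2 * (∫⁻ lam, hsNormSq (J.plField (g n) lam - J.plField f lam) ∂J.plancherel) +
          2 * ∫⁻ lam, hsNormSq (S n lam - T lam) ∂J.plancherel := by
      intro n
      have a1 : AEMeasurable (fun lam => hsNormSq (J.plField (g n) lam - J.plField f lam))
        J.plancherel := ((J.isMeasurableField_plField (g n)).sub hP).aemeasurable_hsNormSq
      have a2 : AEMeasurable (fun lam => hsNormSq (S n lam - T lam)) J.plancherel :=
        ((hS n).sub hT).aemeasurable_hsNormSq
      rw [← lintegral_const_mul'' _ a1, ← lintegral_const_mul'' _ a2,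
        ← lintegral_add_left' (a1.const_mul 2)]
      refine lintegral_mono_ae ?_
      filter_upwards [hSg n] with lam h1
      refine le_trans (le_of_eq ?_) (hsNormSq_sub_le _ _)
      rw [h1]
      congr 1
      abel
    have hlim2 := (ENNReal.Tendsto.const_mul (J.tendsto_lintegral_hsNormSq_plField hlim)
      (Or.inr (ENNReal.ofNat_ne_top (n := 2)))).add
        (ENNReal.Tendsto.const_mul hST (Or.inr (ENNReal.ofNat_ne_top (n := 2))))
    simp only [mul_zero, add_zero] at hlim2
    exact le_antisymm (ge_of_tendsto' hlim2 hle) zero_le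
  have hm : AEMeasurable (fun lam => hsNormSq (T lam - J.plField f lam)) J.plancherel :=
    (hT.sub hP).aemeasurable_hsNormSq
  rw [lintegral_eq_zero_iff' hm] at hzero
  filter_upwards [hzero] with lam h
  exact sub_eq_zero.1 (hsNormSq_eq_zero_iff.1 h)

theorem mem_HE_iff {e : L2R d} {j : ℤ} {f : J.L2N} : f ∈ J.HE e j ↔
    (∀ᵐ lam ∂J.plancherel, lam ∉ ((2 : ℝ) ^ (-j)) • J.E → J.plField f lam = 0) ∧
    (∀ᵐ lam ∂J.plancherel, lam ∈ ((2 : ℝ) ^ (-j)) • J.E →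
      ∃ φ : L2R d, J.plField f lam = InnerProductSpace.rankOne ℂ φ e) := by
  constructor
  · rintro ⟨T, hT, h1, h2⟩
    have h := IsPlancherelTransform.ae_eq J hT
    constructor
    · filter_upwards [h, h1] with lam h h1 hl
      rw [← h, h1 hl]
    · filter_upwards [h, h2] with lam h h2 hl
      rw [← h]
      exact h2 hl
  · rintro ⟨h1, h2⟩
    exact ⟨_, J.isPlancherelTransform_plField f, h1, h2⟩

end AdaptedBasis

namespace AdaptedBasis

variable {𝔫 : Type*} [LieRing 𝔫] [LieAlgebra ℝ 𝔫] {m d : ℕ} (J : AdaptedBasis 𝔫 m d)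

/-! ### The tiling of the frequencies -/

theorem mem_smul_E {j : ℤ} {lam : Euc m} :
    lam ∈ ((2 : ℝ) ^ (-j)) • J.E ↔ (2 : ℝ) ^ j • lam ∈ J.E := by
  rw [Set.mem_smul_set_iff_inv_smul_mem₀ (zpow_ne_zero _ two_ne_zero), zpow_neg, inv_inv]

/-- `E` is a half-open shell for the sup norm, so that its dyadic dilates are disjoint. -/
theorem mem_E_iff {lam : Euc m} :
    lam ∈ J.E ↔ ‖lam.ofLp‖ ∈ Set.Ioc (1 / 4 : ℝ) (1 / 2) ∧ lam ∈ J.Sig := by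
  have h : ∀ r : ℝ, 0 ≤ r → ((∀ l, lam l ∈ Set.Icc (-r) r) ↔ ‖lam.ofLp‖ ≤ r) := by
    intro r hr
    rw [pi_norm_le_iff_of_nonneg hr]
    simp only [Real.norm_eq_abs, abs_le, Set.mem_Icc]
  simp only [E, Set.mem_inter_iff, Set.mem_sdiff, Set.mem_ofPred_eq, neg_div,
    h (1 / 2) (by norm_num), h (1 / 4) (by norm_num), not_le, Set.mem_Ioc]
  tauto

theorem measurableSet_smul_E (j : ℤ) : MeasurableSet (((2 : ℝ) ^ (-j)) • J.E) := by
  refine MeasurableSet.const_smul₀ ?_ _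
  have : J.E = (fun lam : Euc m => ‖lam.ofLp‖) ⁻¹' Set.Ioc (1 / 4 : ℝ) (1 / 2) ∩ J.Sig := by
    ext lam; exact J.mem_E_iff
  rw [this]
  have hc : Continuous fun lam : Euc m => ‖lam.ofLp‖ := by fun_prop
  exact (hc.measurable measurableSet_Ioc).inter J.measurableSet_Sig

theorem eq_of_mem_smul_E {i j : ℤ} {lam : Euc m} (hi : lam ∈ ((2 : ℝ) ^ (-i)) • J.E)
    (hj : lam ∈ ((2 : ℝ) ^ (-j)) • J.E) : i = j := by
  wlog hij : i ≤ j generalizing i j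
  · exact (this hj hi (le_of_not_ge hij)).symm
  rw [mem_smul_E, mem_E_iff, WithLp.ofLp_smul, norm_smul, norm_zpow, Real.norm_ofNat] at hi hj
  by_contra hne
  have hlt : i + 1 ≤ j := by omega
  have h1 : (2 : ℝ) ^ (i + 1) ≤ 2 ^ j := zpow_le_zpow_right₀ one_le_two hlt
  rw [zpow_add_one₀ two_ne_zero] at h1
  have h2 := mul_le_mul_of_nonneg_right h1 (norm_nonneg lam.ofLp)
  have h3 := hi.1.1
  have h4 := hj.1.2
  linarith

/-- Since `𝔫` is not commutative, the `X_i` and `Y_i` occur. -/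
theorem d_ne_zero {d : ℕ} (J : AdaptedBasis 𝔫 m d) : d ≠ 0 := by
  rintro rfl
  refine J.not_abelian ⟨fun V W => ?_⟩
  have h : V ∈ LieAlgebra.center ℝ 𝔫 := by
    rw [J.decomp V]
    simpa [yvec, xvec] using J.zvec_mem _
  exact lie_of_mem' h

theorem exists_mem_smul_E {lam : Euc m} (h : lam ∈ J.Sig) :
    ∃ j : ℤ, lam ∈ ((2 : ℝ) ^ (-j)) • J.E := by
  have h0 : lam ≠ 0 := by
    rintro rfl
    have hB : J.B 0 = 0 := by
      ext i j
      simp [B_apply]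
    have : Nonempty (Fin d) := ⟨⟨0, Nat.pos_of_ne_zero J.d_ne_zero⟩⟩
    exact h (by rw [hB]; exact Matrix.det_zero)
  have hpos : 0 < ‖lam.ofLp‖ := norm_pos_iff.2 fun h1 => h0 (by ext l; exact congrFun h1 l)
  obtain ⟨n, hn⟩ := exists_mem_Ioc_zpow hpos (one_lt_two)
  -- `2^n < ‖λ‖ ≤ 2^(n+1)`, so that `2^(-n-2) λ` lies in the shell
  refine ⟨-n - 2, ?_⟩
  rw [mem_smul_E, mem_E_iff, smul_mem_Sig _ (zpow_ne_zero _ two_ne_zero), WithLp.ofLp_smul,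
    norm_smul, norm_zpow, Real.norm_ofNat]
  refine ⟨?_, h⟩
  have e : (2 : ℝ) ^ (-n - 2) = (2 ^ n)⁻¹ / 4 := by
    rw [zpow_sub₀ two_ne_zero, zpow_neg]; norm_num
  have hp : (0 : ℝ) < 2 ^ n := by positivity
  have h1 := hn.1
  have h2 := hn.2
  rw [zpow_add_one₀ two_ne_zero] at h2
  rw [e]
  constructor
  · rw [div_mul_eq_mul_div, lt_div_iff₀ (by norm_num), inv_mul_eq_div, lt_div_iff₀ hp]
    linarith
  · rw [div_mul_eq_mul_div, div_le_iff₀ (by norm_num), inv_mul_eq_div, div_le_iff₀ hp]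
    linarith

/-! ### Orthogonality -/

section Orthogonality

variable {𝕀 : Type*} (e : HilbertBasis 𝕀 ℂ (L2R d))

theorem rankOne_apply_basis (φ : L2R d) {k l : 𝕀} (h : k ≠ l) :
    InnerProductSpace.rankOne ℂ φ (e k) (e l) = 0 := by
  rw [InnerProductSpace.rankOne_apply, e.orthonormal.2 h, zero_smul]

/-- The Pythagorean identity for Plancherel transforms of which, almost everywhere, at most one is
nonzero on each basis vector. -/
theorem norm_add_sq_of_plField {f g : J.L2N}
    (h : ∀ᵐ lam ∂J.plancherel, ∀ l, J.plField f lam (e l) = 0 ∨ J.plField g lam (e l) = 0) :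
    ‖f + g‖ ^ 2 = ‖f‖ ^ 2 + ‖g‖ ^ 2 := by
  have hs : ‖f + g‖ₑ ^ 2 = ‖f‖ₑ ^ 2 + ‖g‖ₑ ^ 2 := by
    rw [← lintegral_hsNormSq_plField, ← lintegral_hsNormSq_plField, ← lintegral_hsNormSq_plField,
      ← lintegral_add_left' (J.isMeasurableField_plField f).aemeasurable_hsNormSq]
    refine lintegral_congr_ae ?_
    filter_upwards [h, J.plField_add f g] with lam h h'
    rw [h', hsNormSq_add_of_basis e h]
  have := congrArg ENNReal.toReal hs
  rw [ENNReal.toReal_add (ENNReal.pow_ne_top enorm_ne_top)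
    (ENNReal.pow_ne_top enorm_ne_top)] at this
  simpa using this

theorem inner_eq_zero_of_plField {f g : J.L2N}
    (h : ∀ᵐ lam ∂J.plancherel, ∀ l, J.plField f lam (e l) = 0 ∨ J.plField g lam (e l) = 0) :
    inner ℂ f g = 0 := by
  -- The hypothesis is invariant under scaling `g`; `c = 1` and `c = I` give the two parts.
  have hre : ∀ c : ℂ, RCLike.re (inner ℂ f (c • g)) = 0 := by
    intro c
    have h1 := J.norm_add_sq_of_plField e (f := f) (g := c • g) (by
      filter_upwards [h, J.plField_smul c g] with lam h h' l
      rcases h l with h | h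
      · exact Or.inl h
      · right
        rw [h', smul_apply, h, smul_zero])
    rw [@norm_add_sq ℂ] at h1
    linarith
  have h1 := hre 1
  have h2 := hre Complex.I
  rw [one_smul] at h1
  rw [inner_smul_right] at h2
  refine Complex.ext h1 ?_
  simpa using h2

theorem orthogonalFamily_HE {ι : Type*} {κ : ι → 𝕀} (hκ : Function.Injective κ) :
    OrthogonalFamily ℂ (fun p : ι × ℤ => J.HE (e (κ p.1)) p.2)
      (fun p => (J.HE (e (κ p.1)) p.2).subtypeₗᵢ) := by
  rintro ⟨k, i⟩ ⟨k', j⟩ hne ⟨f, hf⟩ ⟨g, hg⟩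
  refine J.inner_eq_zero_of_plField e (f := f) (g := g) ?_
  obtain ⟨f1, f2⟩ := J.mem_HE_iff.1 hf
  obtain ⟨g1, g2⟩ := J.mem_HE_iff.1 hg
  filter_upwards [f1, f2, g1, g2] with lam f1 f2 g1 g2 l
  by_cases hi : lam ∈ ((2 : ℝ) ^ (-i)) • J.E
  · by_cases hj : lam ∈ ((2 : ℝ) ^ (-j)) • J.E
    · have hij := J.eq_of_mem_smul_E hi hj
      have hk : κ k ≠ κ k' := fun h => hne (by rw [hκ h, hij])
      obtain ⟨φ, hφ⟩ := f2 hi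
      obtain ⟨ψ, hψ⟩ := g2 hj
      by_cases hl : κ k = l
      · right
        rw [hψ]
        exact rankOne_apply_basis e ψ (hl ▸ hk.symm)
      · left
        rw [hφ]
        exact rankOne_apply_basis e φ hl
    · right
      rw [g1 hj, zero_apply]
  · left
    rw [f1 hi, zero_apply]

end Orthogonality

/-! ### Dilations -/

/-- The Jacobian of `A^j`. -/
theorem map_A_zpow_haar (j : ℤ) : Measure.map (J.A ^ j : MulAut J.N) J.haar
    = ENNReal.ofReal ((((2 : ℝ) ^ j) ^ (m + d))⁻¹) • J.haar := by
  have h0 : (2 : ℝ) ^ j ≠ 0 := zpow_ne_zero _ two_ne_zero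
  have hpos : (0 : ℝ) < 2 ^ j := by positivity
  set r : ℝ := (2 : ℝ) ^ j with hr
  have hmeas : Measurable fun w : Euc m × Euc d × Euc d => (r • w.1, r • w.2.1, w.2.2) := by
    fun_prop
  have hfun : ((J.A ^ j : MulAut J.N) : J.N → J.N) = J.point ∘
      (fun w : Euc m × Euc d × Euc d => (r • w.1, r • w.2.1, w.2.2)) ∘ J.coords := by
    ext1 b
    obtain ⟨q, rfl⟩ := J.coords.symm.surjective b
    simp [A_zpow_point, hr]
  have hp := J.measurePreserving_point
  have hc := J.measurePreserving_coords
  have hz : ∀ k, Measure.map (r • · : Euc k → Euc k) volume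
      = ENNReal.ofReal ((r ^ k)⁻¹) • volume := fun k => by
    rw [Measure.map_addHaar_smul _ h0, finrank_euclideanSpace_fin, abs_of_pos (by positivity)]
  have hyx : Measure.map (Prod.map (r • ·) id) (volume : Measure (Euc d × Euc d))
      = ENNReal.ofReal ((r ^ d)⁻¹) • volume := by
    rw [Measure.volume_eq_prod, ← Measure.map_prod_map _ _ (by fun_prop) measurable_id, hz,
      Measure.map_id, Measure.prod_smul_left]
  have hall : Measure.map (Prod.map (r • ·) (Prod.map (r • ·) id))
      (volume : Measure (Euc m × Euc d × Euc d)) = ENNReal.ofReal ((r ^ (m + d))⁻¹) • volume := by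
    have : SFinite (Measure.map (Prod.map (r • ·) id) (volume : Measure (Euc d × Euc d))) := by
      rw [hyx]; infer_instance
    rw [Measure.volume_eq_prod, ← Measure.map_prod_map _ _ (by fun_prop) (by fun_prop), hz, hyx,
      Measure.prod_smul_left, Measure.prod_smul_right, smul_smul,
      ← ENNReal.ofReal_mul (by positivity), pow_add, mul_inv]
  rw [hfun, ← Measure.map_map hp.measurable (hmeas.comp hc.measurable),
    ← Measure.map_map hmeas hc.measurable, hc.map_eq]
  change Measure.map J.point (Measure.map (Prod.map (r • ·) (Prod.map (r • ·) id)) volume) = _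
  rw [hall, Measure.map_smul]
  rfl

theorem measurable_A_zpow (j : ℤ) : Measurable (J.A ^ j : MulAut J.N) := (J.map_A_zpow j).1

theorem ae_A_zpow {P : J.N → Prop} (j : ℤ) (h : ∀ᵐ a ∂J.haar, P a) :
    ∀ᵐ a ∂J.haar, P ((J.A ^ j) a) := by
  refine ae_of_ae_map (J.measurable_A_zpow j).aemeasurable ?_
  rw [map_A_zpow_haar]
  exact (Measure.smul_absolutelyContinuous).ae_le h

theorem D_ae (j : ℤ) (f : J.L2N) : J.D j f =ᵐ[J.haar]
    fun a => (((2 : ℝ) ^ (-(j : ℝ) * (m + d) / 2) : ℝ) : ℂ) * f ((J.A ^ (-j)) a) :=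
  (J.memLp_dil j f).coeFn_toLp

/-- `D_{A^j}` as a linear isometry of `L²(N)`. -/
def dil (j : ℤ) : J.L2N →ₗᵢ[ℂ] J.L2N where
  toFun := J.D j
  map_add' f g := by
    refine Lp.ext ?_
    filter_upwards [J.D_ae j (f + g), J.D_ae j f, J.D_ae j g, Lp.coeFn_add (J.D j f) (J.D j g),
      J.ae_A_zpow (-j) (Lp.coeFn_add f g)] with a h1 h2 h3 h4 h5
    rw [h1, h4, Pi.add_apply, h2, h3, h5, Pi.add_apply, mul_add]
  map_smul' c f := by
    refine Lp.ext ?_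
    filter_upwards [J.D_ae j (c • f), J.D_ae j f, Lp.coeFn_smul c (J.D j f),
      J.ae_A_zpow (-j) (Lp.coeFn_smul c f)] with a h1 h2 h3 h4
    rw [h1, RingHom.id_apply, h3, Pi.smul_apply, h2, h4, Pi.smul_apply, smul_eq_mul, smul_eq_mul]
    ring
  norm_map' f := by
    have h : ‖J.D j f‖ₑ ^ 2 = ‖f‖ₑ ^ 2 := by
      have hm : Measurable fun a => ‖f a‖ₑ ^ 2 :=
        (Lp.stronglyMeasurable f).measurable.enorm.pow_const 2
      have h1 := lintegral_map (μ := J.haar) hm (J.measurable_A_zpow (-j))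
      rw [map_A_zpow_haar, lintegral_smul_measure] at h1
      change ‖(J.memLp_dil j f).toLp _‖ₑ ^ 2 = _
      rw [enorm_toLp_two_sq, enorm_Lp_two_sq f]
      simp only [enorm_mul, mul_pow]
      have hm' : Measurable fun a => ‖f ((J.A ^ (-j)) a)‖ₑ ^ 2 :=
        hm.comp (J.measurable_A_zpow (-j))
      rw [lintegral_const_mul _ hm', ← h1, smul_eq_mul,
        ← mul_assoc, ← ofReal_norm, Complex.norm_real, Real.norm_eq_abs,
        abs_of_pos (by positivity), ← ENNReal.ofReal_pow (by positivity),
        ← ENNReal.ofReal_mul (by positivity)]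
      have : ((2 : ℝ) ^ (-(j : ℝ) * (m + d) / 2)) ^ 2 * (((2 : ℝ) ^ (-j)) ^ (m + d))⁻¹ = 1 := by
        rw [← Real.rpow_natCast, ← Real.rpow_mul zero_le_two, ← Real.rpow_intCast,
          ← Real.rpow_natCast, ← Real.rpow_mul zero_le_two, ← Real.rpow_neg zero_le_two,
          ← Real.rpow_add zero_lt_two]
        push_cast
        convert Real.rpow_zero (2 : ℝ) using 2
        ring
      rw [this, ENNReal.ofReal_one, one_mul]
    change ‖J.D j f‖ = ‖f‖
    have h2 := congrArg ENNReal.toReal h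
    simp only [ENNReal.toReal_pow, toReal_enorm] at h2
    exact (pow_left_inj₀ (norm_nonneg _) (norm_nonneg _) two_ne_zero).1 h2

theorem D_D_neg (j : ℤ) (f : J.L2N) : J.D j (J.D (-j) f) = f := by
  refine Lp.ext ?_
  filter_upwards [J.D_ae j (J.D (-j) f), J.ae_A_zpow (-j) (J.D_ae (-j) f)] with a h1 h2
  rw [h1, h2, neg_neg, ← MulAut.mul_apply, ← zpow_add, add_neg_cancel, zpow_zero,
    MulAut.one_apply, ← mul_assoc, ← Complex.ofReal_mul, ← Real.rpow_add zero_lt_two]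
  have : (-(j : ℝ) * (m + d) / 2 + -((-j : ℤ) : ℝ) * (m + d) / 2) = 0 := by push_cast; ring
  rw [this, Real.rpow_zero, Complex.ofReal_one, one_mul]

/-- `π_λ ∘ A^j = π_{2^j λ}`, because `A^j` dilates both `z` and `y`. -/
theorem rep_A_zpow (j : ℤ) (lam : Euc m) (a : J.N) (u : L2R d) :
    J.rep lam ((J.A ^ j) a) u = J.rep ((2 : ℝ) ^ j • lam) a u := by
  obtain ⟨q, rfl⟩ := J.coords.symm.surjective a
  rw [coords_symm_apply, A_zpow_point, rep, rep, MemLp.toLp_eq_toLp_iff]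
  refine Eventually.of_forall fun t => ?_
  simp only [xCoord_point, phase, zCoord_point, yCoord_point, B_smul, inner_smul_left,
    inner_smul_right, WithLp.ofLp_smul, Matrix.mulVec_smul, Matrix.smul_mulVec]
  simp

theorem map_smul_plancherel {r : ℝ} (hr : r ≠ 0) : ∃ c : ℝ≥0∞, c ≠ ∞ ∧
    Measure.map (r • · : Euc m → Euc m) J.plancherel = c • J.plancherel := by
  have hSig : volume.restrict J.Sig = (volume : Measure (Euc m)) :=
    Measure.restrict_eq_self_of_ae_mem J.ae_mem_Sig
  have hdet : Measurable fun lam => ENNReal.ofReal |(J.B lam).det| :=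
    (J.continuous_B.matrix_det.measurable.abs).ennreal_ofReal
  set c1 : ℝ≥0∞ := ENNReal.ofReal |(r ^ Module.finrank ℝ (Euc m))⁻¹| with hc1
  set c2 : ℝ≥0∞ := ENNReal.ofReal |(r ^ d)⁻¹| with hc2
  refine ⟨c2 * c1, ENNReal.mul_ne_top ENNReal.ofReal_ne_top ENNReal.ofReal_ne_top, ?_⟩
  refine Measure.ext_of_lintegral _ fun F hF => ?_
  have hsm : Measurable (r • · : Euc m → Euc m) := by fun_prop
  have hFr : Measurable fun lam : Euc m => F (r • lam) := hF.comp hsm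
  rw [lintegral_map hF hsm, lintegral_smul_measure, plancherel, hSig,
    lintegral_withDensity_eq_lintegral_mul _ hdet hFr,
    lintegral_withDensity_eq_lintegral_mul _ hdet hF]
  have h1 := lintegral_map (μ := (volume : Measure (Euc m))) (hdet.mul hF) hsm
  rw [Measure.map_addHaar_smul _ hr, lintegral_smul_measure] at h1
  simp only [smul_eq_mul] at h1 ⊢
  have hcomp : Measurable fun a : Euc m => ((fun lam => ENNReal.ofReal |(J.B lam).det|) * F)
      (r • a) := (hdet.mul hF).comp hsm
  rw [mul_assoc, h1, ← lintegral_const_mul _ hcomp]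
  refine lintegral_congr fun lam => ?_
  simp only [Pi.mul_apply, B_smul, Matrix.det_smul, Fintype.card_fin]
  rw [← mul_assoc, hc2, ← ENNReal.ofReal_mul (abs_nonneg _), ← abs_mul, ← mul_assoc,
    inv_mul_cancel₀ (pow_ne_zero _ hr), one_mul]

theorem ae_smul_plancherel {P : Euc m → Prop} {r : ℝ} (hr : r ≠ 0)
    (h : ∀ᵐ lam ∂J.plancherel, P lam) : ∀ᵐ lam ∂J.plancherel, P (r • lam) := by
  obtain ⟨c, -, hc⟩ := J.map_smul_plancherel hr
  refine ae_of_ae_map (f := fun lam : Euc m => r • lam) (by fun_prop) ?_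
  rw [hc]
  exact (Measure.smul_absolutelyContinuous).ae_le h

theorem IsMeasurableField.comp_smul {T : Euc m → L2R d →L[ℂ] L2R d}
    (hT : IsMeasurableField J.plancherel T) {r : ℝ} (hr : r ≠ 0) :
    IsMeasurableField J.plancherel (fun lam => T (r • lam)) := by
  obtain ⟨c, -, hc⟩ := J.map_smul_plancherel hr
  intro u v
  have hq : Measure.QuasiMeasurePreserving (r • · : Euc m → Euc m) J.plancherel J.plancherel :=
    ⟨by fun_prop, by rw [hc]; exact Measure.smul_absolutelyContinuous⟩
  exact (hT u v).comp_quasiMeasurePreserving hq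

/-- The effect of a dilation on the Plancherel transform; the factor is that of `D_{A^j}` times the
Jacobian of `A^j`. -/
theorem IsPlancherelTransform.dil {f : J.L2N} {T : Euc m → L2R d →L[ℂ] L2R d} (j : ℤ)
    (h : J.IsPlancherelTransform f T) : ∃ c : ℂ,
    J.IsPlancherelTransform (J.D j f) (fun lam => c • T ((2 : ℝ) ^ j • lam)) := by
  have hr : (2 : ℝ) ^ j ≠ 0 := zpow_ne_zero _ two_ne_zero
  obtain ⟨hT, g, S, hg, hS, hFT, hlim, hST⟩ := h
  set κ : ℂ := (((2 : ℝ) ^ (-(j : ℝ) * (m + d) / 2) : ℝ) : ℂ) with hκ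
  set C : ℝ := (((2 : ℝ) ^ (-j)) ^ (m + d))⁻¹ with hC
  have hC0 : 0 ≤ C := by positivity
  have hmap : Measure.map (J.A ^ (-j) : MulAut J.N) J.haar = ENNReal.ofReal C • J.haar :=
    J.map_A_zpow_haar (-j)
  have hAm := J.measurable_A_zpow (-j)
  refine ⟨κ * C, (IsMeasurableField.comp_smul J hT hr).smul _, fun n => J.D j (g n),
    fun n lam => (κ * C) • S n ((2 : ℝ) ^ j • lam), fun n => ?_,
    fun n => (IsMeasurableField.comp_smul J (hS n) hr).smul _, fun n => ?_,
    ((J.dil j).continuous.tendsto f).comp hlim, ?_⟩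
  · refine Integrable.congr (Integrable.const_mul ?_ κ) (J.D_ae j (g n)).symm
    have h1 : Integrable (g n) (Measure.map (J.A ^ (-j) : MulAut J.N) J.haar) := by
      rw [hmap]
      exact (hg n).smul_measure ENNReal.ofReal_ne_top
    exact h1.comp_measurable hAm
  · filter_upwards [J.ae_smul_plancherel hr (hFT n)] with lam hlam u v
    rw [smul_apply, inner_smul_right, hlam u v]
    have h1 := integral_map (μ := J.haar) (φ := (J.A ^ (-j) : MulAut J.N))
      (f := fun b => g n b * inner ℂ v (J.rep ((2 : ℝ) ^ j • lam) b u)) hAm.aemeasurable (by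
        rw [hmap]
        exact ((J.integrable_coeff (hg n) _ u v).smul_measure ENNReal.ofReal_ne_top).1)
    rw [hmap, integral_smul_measure, ENNReal.toReal_ofReal hC0] at h1
    have h2 : ((κ * C) * ∫ b, g n b * inner ℂ v (J.rep ((2 : ℝ) ^ j • lam) b u) ∂J.haar)
        = κ * (C • ∫ b, g n b * inner ℂ v (J.rep ((2 : ℝ) ^ j • lam) b u) ∂J.haar) := by
      rw [Complex.real_smul, mul_assoc]
    rw [h2, h1, ← integral_const_mul]
    refine integral_congr_ae ?_
    filter_upwards [J.D_ae j (g n)] with a ha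
    rw [ha, ← rep_A_zpow, ← MulAut.mul_apply, ← zpow_add, add_neg_cancel, zpow_zero,
      MulAut.one_apply, mul_assoc]
  · obtain ⟨c, hc, hcmap⟩ := J.map_smul_plancherel hr
    have hsm : Measurable ((2 : ℝ) ^ j • · : Euc m → Euc m) := by fun_prop
    have key : ∀ n, ∫⁻ lam, hsNormSq ((κ * C) • S n ((2 : ℝ) ^ j • lam)
        - (κ * C) • T ((2 : ℝ) ^ j • lam)) ∂J.plancherel
        = (‖κ * C‖ₑ ^ 2 * c) * ∫⁻ lam, hsNormSq (S n lam - T lam) ∂J.plancherel := by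
      intro n
      have a1 : AEMeasurable (fun lam => hsNormSq (S n lam - T lam)) J.plancherel :=
        ((hS n).sub hT).aemeasurable_hsNormSq
      have a2 : AEMeasurable (fun lam => hsNormSq (S n ((2 : ℝ) ^ j • lam)
          - T ((2 : ℝ) ^ j • lam))) J.plancherel :=
        ((IsMeasurableField.comp_smul J (hS n) hr).sub
          (IsMeasurableField.comp_smul J hT hr)).aemeasurable_hsNormSq
      have h1 := lintegral_map' (μ := J.plancherel) (g := ((2 : ℝ) ^ j • · : Euc m → Euc m))
        (f := fun lam => hsNormSq (S n lam - T lam)) (by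
          rw [hcmap]; exact a1.smul_measure c) hsm.aemeasurable
      rw [hcmap, lintegral_smul_measure, smul_eq_mul] at h1
      simp only [← smul_sub, hsNormSq_smul]
      rw [lintegral_const_mul'' _ a2, mul_assoc, h1]
    simp only [key]
    have := ENNReal.Tendsto.const_mul hST (Or.inr (ENNReal.mul_ne_top (a := ‖κ * C‖ₑ ^ 2)
      (ENNReal.pow_ne_top enorm_ne_top) hc))
    simpa using this

theorem D_mem_HE {e : L2R d} {i : ℤ} {f : J.L2N} (j : ℤ) (hf : f ∈ J.HE e i) :
    J.D j f ∈ J.HE e (i + j) := by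
  obtain ⟨T, hT, h1, h2⟩ := hf
  obtain ⟨c, hc⟩ := IsPlancherelTransform.dil J j hT
  have hr : (2 : ℝ) ^ j ≠ 0 := zpow_ne_zero _ two_ne_zero
  have htile : ∀ lam : Euc m, lam ∈ ((2 : ℝ) ^ (-(i + j))) • J.E ↔
      (2 : ℝ) ^ j • lam ∈ ((2 : ℝ) ^ (-i)) • J.E := fun lam => by
    rw [mem_smul_E, mem_smul_E, smul_smul, zpow_add₀ two_ne_zero]
  refine ⟨_, hc, ?_, ?_⟩
  · filter_upwards [J.ae_smul_plancherel hr h1] with lam h hl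
    rw [h (mt (htile lam).2 hl), smul_zero]
  · filter_upwards [J.ae_smul_plancherel hr h2] with lam h hl
    obtain ⟨φ, hφ⟩ := h ((htile lam).1 hl)
    exact ⟨c • φ, by rw [hφ, map_smul, smul_apply]⟩

end AdaptedBasis

theorem IsParsevalFrame.comp_equiv {H : Type*} [NormedAddCommGroup H] [InnerProductSpace ℂ H]
    {ι ι' : Type*} {v : ι → H} {K : Submodule ℂ H} (h : IsParsevalFrame v K) (σ : ι' ≃ ι) :
    IsParsevalFrame (fun i => v (σ i)) K :=
  ⟨fun i => h.1 (σ i), fun g hg =>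
    (σ.hasSum_iff (f := fun i => ‖inner ℂ (v i) g‖ ^ 2)).2 (h.2 g hg)⟩

namespace AdaptedBasis

variable {𝔫 : Type*} [LieRing 𝔫] [LieAlgebra ℝ 𝔫] {m d : ℕ} (J : AdaptedBasis 𝔫 m d)

/-! ### Surjectivity of the Plancherel transform -/

/-- The inverse of `freqLin` at the points of `Σ`, by Cramer's rule. -/
def freqInv (lam : Euc m) (η : Euc d) : Euc d :=
  ((-(J.B lam).transpose).det)⁻¹ •
    WithLp.toLp 2 ((-(J.B lam).transpose).adjugate.mulVec η.ofLp)

theorem freqInv_freqLin {lam : Euc m} (h : lam ∈ J.Sig) (t : Euc d) :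
    J.freqInv lam (J.freqLin lam t) = t := by
  have hdet : (-(J.B lam).transpose).det ≠ 0 := by
    rw [Matrix.det_neg, Matrix.det_transpose]
    exact mul_ne_zero (pow_ne_zero _ (by norm_num)) h
  rw [freqInv, freqLin, Matrix.toLpLin_apply, Matrix.mulVec_mulVec, Matrix.adjugate_mul,
    Matrix.smul_mulVec, Matrix.one_mulVec, WithLp.toLp_smul, smul_smul, inv_mul_cancel₀ hdet,
    one_smul]

theorem measurable_freqInv : Measurable fun q : Euc m × Euc d × Euc d => J.freqInv q.1 q.2.1 := by
  have h1 : Continuous fun q : Euc m × Euc d × Euc d => -(J.B q.1).transpose :=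
    (J.continuous_B.comp continuous_fst).matrix_transpose.neg
  have h2 : Continuous fun q : Euc m × Euc d × Euc d =>
      (WithLp.toLp 2 ((-(J.B q.1).transpose).adjugate.mulVec q.2.1.ofLp) : Euc d) :=
    (PiLp.continuous_toLp 2 _).comp (h1.matrix_adjugate.matrix_mulVec (by fun_prop))
  exact h1.matrix_det.measurable.inv.smul h2.measurable

/-- Every square integrable family of kernels comes from a function in `L²(N)`. -/
theorem exists_symbol_eq {h : Euc m × Euc d × Euc d → ℂ} (hm : Measurable h)
    (hfin : ∫⁻ lam, ∫⁻ p, ‖h (lam, p)‖ₑ ^ 2 ∂(volume.prod volume) ∂J.plancherel < ∞) :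
    ∃ g : J.L2N, ∀ᵐ lam ∂J.plancherel,
      J.symbol (J.eucFourier g) lam =ᵐ[volume.prod volume] fun p => h (lam, p) := by
  -- `symbol` is inverted by undoing the substitution `η = -B(λ)ᵀ t` and the character.
  obtain ⟨G, hG⟩ : ∃ G : Euc m × Euc d × Euc d → ℂ, ∀ q, G q =
      h (q.1, J.freqInv q.1 q.2.1, q.2.2) * starRingEnd ℂ (char (J.freqInv q.1 q.2.1) q.2.2) :=
    ⟨_, fun _ => rfl⟩
  have hinv := J.measurable_freqInv
  have hsnd : Measurable fun q : Euc m × Euc d × Euc d => q.2.2 := by fun_prop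
  have hGm : Measurable G := by
    have h1 : Measurable fun q : Euc m × Euc d × Euc d => (q.1, J.freqInv q.1 q.2.1, q.2.2) :=
      measurable_fst.prodMk (hinv.prodMk hsnd)
    have h2 : Measurable fun q : Euc m × Euc d × Euc d =>
        char (J.freqInv q.1 q.2.1) q.2.2 := by
      have h := (continuous_char (d := d)).measurable.comp (hinv.prodMk hsnd)
      exact h
    have h3 : Measurable fun q : Euc m × Euc d × Euc d =>
        h (q.1, J.freqInv q.1 q.2.1, q.2.2) := hm.comp h1
    have h4 : Measurable fun q : Euc m × Euc d × Euc d =>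
        starRingEnd ℂ (char (J.freqInv q.1 q.2.1) q.2.2) :=
      Complex.continuous_conj.measurable.comp h2
    rw [funext hG]
    exact h3.mul h4
  have hsym : ∀ lam ∈ J.Sig, J.symbol G lam = fun p => h (lam, p) := by
    intro lam hlam
    funext p
    have h1 : starRingEnd ℂ (char p.1 p.2) * char p.1 p.2 = 1 := by
      rw [← Complex.normSq_eq_conj_mul_self, Complex.normSq_eq_norm_sq, norm_char]
      simp
    rw [symbol, hG, J.freqInv_freqLin hlam]
    rw [mul_assoc, h1, mul_one]
  have hSig := J.ae_plancherel_of_ae J.ae_mem_Sig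
  have hGfin : ∫⁻ q, ‖G q‖ₑ ^ 2 < ∞ := by
    rw [← J.lintegral_symbol hGm]
    refine lt_of_eq_of_lt (lintegral_congr_ae ?_) hfin
    filter_upwards [hSig] with lam hlam
    rw [hsym lam hlam]
  have hGL : MemLp G 2 volume := memLp_two_iff_lintegral.2 ⟨hGm.aestronglyMeasurable, hGfin⟩
  refine ⟨J.eucFourier.symm (hGL.toLp G), ?_⟩
  rw [LinearIsometryEquiv.apply_symm_apply]
  filter_upwards [hSig, J.symbol_congr hGL.coeFn_toLp] with lam hlam h1
  rwa [hsym lam hlam] at h1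

section Totality

variable {𝕀 : Type*} (e : HilbertBasis 𝕀 ℂ (L2R d))

/-- The component of `f` in `H_E^{j,k}`: its Plancherel transform is that of `f` cut down to the
tile `2^{-j}E` and composed with the projection to `e_k`. -/
theorem exists_component (f : J.L2N) (k : 𝕀) (j : ℤ) : ∃ g : J.L2N, ∀ᵐ lam ∂J.plancherel,
    (lam ∈ ((2 : ℝ) ^ (-j)) • J.E →
      J.plField g lam = InnerProductSpace.rankOne ℂ (J.plField f lam (e k)) (e k)) ∧
    (lam ∉ ((2 : ℝ) ^ (-j)) • J.E → J.plField g lam = 0) := by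
  set U := Lp.fourierTransformₗᵢ (Euc d) ℂ with hU
  set c : L2R d := U.symm (e k) with hc
  set tile : Set (Euc m) := ((2 : ℝ) ^ (-j)) • J.E with htile
  have htm : MeasurableSet tile := J.measurableSet_smul_E j
  have hcm : Measurable c := (Lp.stronglyMeasurable c).measurable
  have hcnorm : ∫⁻ ξ, ‖starRingEnd ℂ (c ξ)‖ₑ ^ 2 = 1 := by
    have h1 : ‖c‖ₑ ^ 2 = 1 := by
      rw [← ofReal_norm, hc, LinearIsometryEquiv.norm_map, e.orthonormal.1 k]
      simp
    rw [← h1, enorm_Lp_two_sq]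
    refine lintegral_congr fun ξ => ?_
    rw [← ofReal_norm, ← ofReal_norm, RCLike.norm_conj]
  -- `P(λ, ·)` is a jointly measurable version of `plField f λ (e k)`.
  set P : Euc m × Euc d → ℂ := fun r => ∫ ξ, J.symbol (J.eucFourier f) r.1 (r.2, ξ) * c ξ with hP
  have hPm : Measurable P := by
    have h1 : Measurable fun r : (Euc m × Euc d) × Euc d => (r.1.1, r.1.2, r.2) := by fun_prop
    have h2 : Measurable fun r : (Euc m × Euc d) × Euc d =>
        J.symbol (J.eucFourier f) r.1.1 (r.1.2, r.2) * c r.2 :=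
      ((J.measurable_symbol (J.measurable_eucFourier f)).comp h1).mul (hcm.comp measurable_snd)
    exact (h2.stronglyMeasurable.integral_prod_right' (ν := volume)).measurable
  have hPop : ∀ lam (hl : MemLp (J.symbol (J.eucFourier f) lam) 2 (volume.prod volume)),
      (memLp_kernel hl c).1.toLp (fun t => P (lam, t)) = J.plField f lam (e k) := by
    intro lam hl
    rw [J.plField_eq hl]
    rfl
  set h : Euc m × Euc d × Euc d → ℂ := fun q =>
    tile.indicator 1 q.1 * (P (q.1, q.2.1) * starRingEnd ℂ (c q.2.2)) with hh
  have hhm : Measurable h := by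
    have h1 : Measurable fun q : Euc m × Euc d × Euc d => (q.1, q.2.1) := by fun_prop
    have h2 : Measurable fun q : Euc m × Euc d × Euc d => q.2.2 := by fun_prop
    exact ((measurable_one.indicator htm).comp measurable_fst).mul
      ((hPm.comp h1).mul (continuous_star.measurable.comp (hcm.comp h2)))
  have hfin : ∫⁻ lam, ∫⁻ p, ‖h (lam, p)‖ₑ ^ 2 ∂(volume.prod volume) ∂J.plancherel < ∞ := by
    refine lt_of_le_of_lt (lintegral_mono_ae ?_)
      ((J.lintegral_hsNormSq_plField f).trans_lt (ENNReal.pow_lt_top enorm_lt_top))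
    filter_upwards [J.ae_memLp_symbol f] with lam hl
    have h1 : ∫⁻ p : Euc d × Euc d, ‖P (lam, p.1) * starRingEnd ℂ (c p.2)‖ₑ ^ 2
        ∂(volume.prod volume) = ‖J.plField f lam (e k)‖ₑ ^ 2 := by
      rw [← hPop lam hl, enorm_toLp_two_sq]
      simp only [enorm_mul, mul_pow]
      rw [lintegral_prod_mul (f := fun t => ‖P (lam, t)‖ₑ ^ 2)
        (g := fun ξ => ‖starRingEnd ℂ (c ξ)‖ₑ ^ 2)
        ((hPm.comp measurable_prodMk_left).enorm.pow_const 2).aemeasurable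
        ((continuous_star.measurable.comp hcm).enorm.pow_const 2).aemeasurable, hcnorm, mul_one]
    calc ∫⁻ p, ‖h (lam, p)‖ₑ ^ 2 ∂(volume.prod volume)
        ≤ ∫⁻ p : Euc d × Euc d, ‖P (lam, p.1) * starRingEnd ℂ (c p.2)‖ₑ ^ 2
            ∂(volume.prod volume) := by
          refine lintegral_mono fun p => ?_
          by_cases hl : lam ∈ tile <;> simp [hh, hl]
      _ = ‖J.plField f lam (e k)‖ₑ ^ 2 := h1
      _ ≤ hsNormSq (J.plField f lam) := by
          rw [hsNormSq_eq e]
          exact ENNReal.le_tsum k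
  obtain ⟨g, hg⟩ := J.exists_symbol_eq hhm hfin
  refine ⟨g, ?_⟩
  filter_upwards [hg, J.ae_memLp_symbol f, J.ae_memLp_symbol g] with lam h1 h2 h3
  constructor
  · intro hl
    have hφ := (memLp_kernel h2 c).1
    have h4 : kernelOp h3 = InnerProductSpace.rankOne ℂ (J.plField f lam (e k)) c := by
      rw [← hPop lam h2, ← kernelOp_mul hφ c]
      refine kernelOp_congr _ _ (h1.trans (Eventually.of_forall fun p => ?_))
      simp [hh, hl, hP]
    rw [J.plField_eq h3, h4]
    ext1 u
    change InnerProductSpace.rankOne ℂ (J.plField f lam (e k)) c (U.symm u) = _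
    rw [InnerProductSpace.rankOne_apply, InnerProductSpace.rankOne_apply, hc,
      LinearIsometryEquiv.inner_map_map]
  · intro hl
    have h4 : kernelOp h3 = 0 := by
      rw [← hsNormSq_eq_zero_iff, hsNormSq_kernelOp]
      refine (lintegral_congr_ae (g := 0) ?_).trans lintegral_zero
      filter_upwards [h1] with p hp
      rw [hp]
      simp [hh, hl]
    rw [J.plField_eq h3, h4, ContinuousLinearMap.zero_comp]

/-- The spaces `H_E^{j,k}` are total. -/
theorem eq_zero_of_forall_inner_HE {f : J.L2N}
    (hf : ∀ k (j : ℤ), ∀ g ∈ J.HE (e k) j, inner ℂ g f = 0) : f = 0 := by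
  have hcount : Countable 𝕀 := countable_of_hilbertBasis e
  have hkey : ∀ k (j : ℤ), ∀ᵐ lam ∂J.plancherel, lam ∈ ((2 : ℝ) ^ (-j)) • J.E →
      J.plField f lam (e k) = 0 := by
    intro k j
    obtain ⟨g, hg⟩ := J.exists_component e f k j
    have hmem : g ∈ J.HE (e k) j := by
      rw [mem_HE_iff]
      constructor
      · filter_upwards [hg] with lam h hl using h.2 hl
      · filter_upwards [hg] with lam h hl using ⟨_, h.1 hl⟩
    -- `g` is the orthogonal projection of `f` to `H_E^{j,k}`, hence zero.
    have horth : inner ℂ g (f - g) = 0 := by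
      refine J.inner_eq_zero_of_plField e ?_
      filter_upwards [hg, J.plField_sub f g] with lam h1 h2 l
      by_cases hl : lam ∈ ((2 : ℝ) ^ (-j)) • J.E
      · by_cases hkl : k = l
        · right
          subst hkl
          have h3 : inner ℂ (e k) (e k) = (1 : ℂ) := by
            rw [inner_self_eq_norm_sq_to_K, e.orthonormal.1 k]; simp
          rw [h2, sub_apply, h1.1 hl, InnerProductSpace.rankOne_apply, h3, one_smul, sub_self]
        · left
          rw [h1.1 hl]
          exact rankOne_apply_basis e _ hkl
      · left
        rw [h1.2 hl, zero_apply]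
    rw [inner_sub_right, hf k j g hmem, zero_sub, neg_eq_zero, inner_self_eq_zero] at horth
    have h0 := J.plField_smul 0 g
    filter_upwards [hg, h0] with lam h1 h2 hl
    rw [zero_smul, zero_smul, ← horth, h1.1 hl] at h2
    have h3 := congrArg (fun T : L2R d →L[ℂ] L2R d => T (e k)) h2
    have h4 : inner ℂ (e k) (e k) = (1 : ℂ) := by
      rw [inner_self_eq_norm_sq_to_K, e.orthonormal.1 k]; simp
    simpa only [InnerProductSpace.rankOne_apply, h4, one_smul, zero_apply] using h3
  have hall : ∀ᵐ lam ∂J.plancherel, hsNormSq (J.plField f lam) = 0 := by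
    filter_upwards [ae_all_iff.2 fun k => ae_all_iff.2 fun j => hkey k j,
      J.ae_plancherel_of_ae J.ae_mem_Sig] with lam h1 h2
    obtain ⟨j, hj⟩ := J.exists_mem_smul_E h2
    rw [hsNormSq_eq e]
    simp [h1 _ j hj]
  have hz := J.lintegral_hsNormSq_plField f
  rw [lintegral_congr_ae hall, lintegral_zero] at hz
  have := pow_eq_zero_iff (two_ne_zero) |>.1 hz.symm
  exact enorm_eq_zero.1 this

theorem topologicalClosure_iSup_HE :
    (⨆ p : 𝕀 × ℤ, J.HE (e p.1) p.2).topologicalClosure = ⊤ := by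
  rw [Submodule.topologicalClosure_eq_top_iff, Submodule.eq_bot_iff]
  intro f hf
  refine J.eq_zero_of_forall_inner_HE e fun k j g hg => ?_
  exact (Submodule.mem_orthogonal _ _).1 hf g
    (Submodule.mem_iSup_of_mem (p := fun p : 𝕀 × ℤ => J.HE (e p.1) p.2) (k, j) hg)

end Totality

/-! ### Wavelet frames -/

theorem isParsevalFrame_D {v : J.Gam → J.L2N} {e : L2R d} (hv : IsParsevalFrame v (J.HE e 0))
    (j : ℤ) : IsParsevalFrame (fun γ => J.D j (v γ)) (J.HE e j) := by
  refine ⟨fun γ => by simpa using J.D_mem_HE j (hv.1 γ), fun g hg => ?_⟩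
  have h1 : J.D (-j) g ∈ J.HE e 0 := by simpa using J.D_mem_HE (-j) hg
  have h2 := hv.2 _ h1
  have h3 : ∀ γ, inner ℂ (J.D j (v γ)) g = inner ℂ (v γ) (J.D (-j) g) := fun γ => by
    conv_lhs => rw [← J.D_D_neg j g]
    exact (J.dil j).inner_map_map _ _
  have h4 : ‖J.D (-j) g‖ = ‖g‖ := (J.dil (-j)).norm_map g
  simpa only [h3, h4] using h2

theorem isParsevalFrame_iSup_HE {𝕀 ι : Type*} (e : HilbertBasis 𝕀 ℂ (L2R d)) (f : 𝕀 → J.L2N)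
    {κ : ι → 𝕀} (hκ : Function.Injective κ)
    (h : ∀ k, IsParsevalFrame (fun γ : J.Gam => J.L γ (f (κ k))) (J.HE (e (κ k)) 0)) :
    IsParsevalFrame (fun p : J.Gam × ℤ × ι => J.D p.2.1 (J.L p.1 (f (κ p.2.2))))
      (⨆ p : ι × ℤ, J.HE (e (κ p.1)) p.2).topologicalClosure := by
  have h1 := IsParsevalFrame.iSup (J.orthogonalFamily_HE e hκ)
    (v := fun p (γ : J.Gam) => J.D p.2 (J.L γ (f (κ p.1))))
    fun p => J.isParsevalFrame_D (h p.1) p.2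
  exact h1.topologicalClosure.comp_equiv
    ((Equiv.prodComm _ _).trans ((Equiv.prodComm _ _).prodCongr (Equiv.refl _)))

end AdaptedBasis

theorem mainTheorem3 {𝔫 : Type*} [LieRing 𝔫] [LieAlgebra ℝ 𝔫] {m d : ℕ}
    (J : AdaptedBasis 𝔫 m d) {𝕀 : Type*} (e : HilbertBasis 𝕀 ℂ (L2R d)) (f : 𝕀 → J.L2N) :
    (∀ S : Finset 𝕀,
      (∀ k ∈ S, IsParsevalFrame (fun γ : J.Gam => J.L γ (f k)) (J.HE (e k) 0)) →
      OrthogonalFamily ℂ (fun p : S × ℤ => J.HE (e p.1) p.2)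
          (fun p => (J.HE (e p.1) p.2).subtypeₗᵢ) ∧
        IsParsevalFrame (fun p : J.Gam × ℤ × S => J.D p.2.1 (J.L p.1 (f p.2.2)))
          (⨆ p : S × ℤ, J.HE (e p.1) p.2).topologicalClosure) ∧
    ((∀ k, IsParsevalFrame (fun γ : J.Gam => J.L γ (f k)) (J.HE (e k) 0)) →
      IsParsevalFrame (fun p : J.Gam × ℤ × 𝕀 => J.D p.2.1 (J.L p.1 (f p.2.2))) ⊤) := by
  constructor
  · intro S hS
    have h1 := J.orthogonalFamily_HE e (κ := fun k : S => (k : 𝕀)) Subtype.val_injective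
    have h2 := J.isParsevalFrame_iSup_HE e f (κ := fun k : S => (k : 𝕀)) Subtype.val_injective
      fun k => hS k k.2
    exact ⟨h1, h2⟩
  · intro h
    have h1 := J.isParsevalFrame_iSup_HE e f (κ := fun k : 𝕀 => k) Function.injective_id h
    rwa [J.topologicalClosure_iSup_HE e] at h1

end
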